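/- Let $\mathbf A=(\mathcal P,\mathcal L,\parallel)$ and $\mathbf A'=(\mathcal P',\mathcal L',\parallel')$ be affine spaces (of arbitrary, possibly infinite dimension, given by points, lines and parallelism; non-Desarguesian affine planes are allowed) with $\dim\mathbf A'\ge 3$. Call two lines related, $a\sim b$, if $a\cap b\neq\emptyset$. Let $\varphi:\mathcal L\to\mathcal L'$, $a\mapsto a^\varphi$, be a bijection such that $a\sim b$ implies $a^\varphi\sim' b^\varphi$ for all $a,b\in\mathcal L$. Then there is exactly one map $\lambda:\mathcal P\to\mathcal P'$ such that $a^\varphi\cap b^\varphi=\{\lambda(Q)\}$ whenever $a,b\in\mathcal L$ are distinct lines and $Q\in a\cap b$. This map $\lambda$ is a collineation, i.e. a bijection of $\mathcal P$ onto $\mathcal P'$ preserving collinearity and non-collinearity of points, if any one of the following conditions holds: 1. $\mathbf A$ or $\mathbf A'$ is finite, i.e. has only finitely many points; 2. $\dim\mathbf A\le\dim\mathbf A'<\infty$; 3. the order of $\mathbf A$ (the number of points on each line) is different from two, and $F$, $F'$ are (not necessarily commutative) underlying fields of $\mathbf A$, $\mathbf A'$, i.e. $\mathbf A$ and $\mathbf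 A'$ are, up to isomorphism, the affine spaces of a left vector space over $F$ and of a left vector space over $F'$, respectively, such that every field monomorphism $F\to F'$ is surjective; 4. both $\mathbf A$ and $\mathbf A'$ have order two. -/

import Mathlib

universe u u' v

/-- An affine space `(P, lines, ∥)` of arbitrary (possibly infinite) dimension, given by the
usual synthetic axioms.  All affine planes (Desarguesian or not) are included, and so are the
spaces of order two, where the parallelism is an essential part of the structure. -/
structure AffineSpace (P : Type u) where
  /-- the set of lines; a line is a set of points -/
  lines : Set (Set P)
  /-- the parallelism -/
  Parallel : lines → lines → Prop
  nonempty : Nonempty P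
  /-- two distinct points are joined by exactly one line -/
  existsUnique_line : ∀ x y : P, x ≠ y → ∃! l : lines, x ∈ l.1 ∧ y ∈ l.1
  /-- every line has at least two points -/
  line_nontrivial : ∀ l : lines, l.1.Nontrivial
  /-- parallelism is an equivalence relation -/
  parallel_equivalence : Equivalence Parallel
  /-- there is exactly one parallel to a given line through a given point -/
  existsUnique_parallel : ∀ (x : P) (l : lines), ∃! m : lines, x ∈ m.1 ∧ Parallel m l
  /-- triangle axiom: if `a, b, c` is a triangle with sides `ab = u`, `bc = v`, `ac = w` and
  `a' ≠ b'` are points whose joining line `u'` is parallel to `u`, then there is a point `c'`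
  such that `b'c'` is parallel to `v` and `a'c'` is parallel to `w` -/
  triangle : ∀ (a b c a' b' : P) (u v w u' : lines),
    a ≠ b → a ∈ u.1 → b ∈ u.1 → c ∉ u.1 → b ∈ v.1 → c ∈ v.1 → a ∈ w.1 → c ∈ w.1 →
    a' ≠ b' → a' ∈ u'.1 → b' ∈ u'.1 → Parallel u' u →
    ∃ (c' : P) (v' w' : lines), b' ∈ v'.1 ∧ c' ∈ v'.1 ∧ Parallel v' v ∧
      a' ∈ w'.1 ∧ c' ∈ w'.1 ∧ Parallel w' w

namespace AffineSpace

variable {P : Type u} {P' : Type u'}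

/-- Two lines are related if they have a common point. -/
def Related (A : AffineSpace P) (a b : A.lines) : Prop :=
  (a.1 ∩ b.1).Nonempty

/-- Three points are collinear if some line contains all of them. -/
def Collinear (A : AffineSpace P) (x y z : P) : Prop :=
  ∃ l ∈ A.lines, x ∈ l ∧ y ∈ l ∧ z ∈ l

/-- A subspace is a set of points that contains, with any two distinct points, their joining
line, and, with any point and any line, the parallel to that line through that point. -/
def IsSubspace (A : AffineSpace P) (S : Set P) : Prop :=
  (∀ l : A.lines, ∀ x ∈ S, ∀ y ∈ S, x ≠ y → x ∈ l.1 → y ∈ l.1 → l.1 ⊆ S) ∧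
  (∀ l m : A.lines, ∀ x ∈ S, l.1 ⊆ S → x ∈ m.1 → A.Parallel m l → m.1 ⊆ S)

/-- The subspace spanned by a set of points. -/
def span (A : AffineSpace P) (s : Set P) : Set P :=
  ⋂₀ {S | A.IsSubspace S ∧ s ⊆ S}

/-- The dimension: the least `n` such that some `n + 1` points span the whole space, and `∞`
if no finite set of points does. -/
noncomputable def dim (A : AffineSpace P) : ℕ∞ :=
  ⨅ n ∈ {n : ℕ | ∃ s : Set P, s.encard = n + 1 ∧ A.span s = Set.univ}, (n : ℕ∞)

/-- The space has order `κ`: every line consists of exactly `κ` points. (In an affine space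
any two lines have the same number of points.) -/
def HasOrder (A : AffineSpace P) (κ : Cardinal.{u}) : Prop :=
  ∀ l : A.lines, Cardinal.mk l.1 = κ

/-- The line through the point `p` with direction `x` in an affine space over a (left) vector
space. -/
def vectorLine (F : Type v) {V : Type u} [DivisionRing F] [AddCommGroup V] [Module F V]
    [AddTorsor V P] (p : P) (x : V) : Set P :=
  Set.range fun t : F => t • x +ᵥ p

/-- `F` is an underlying (not necessarily commutative) field of `A`: the points of `A` form an
affine space over some left vector space over `F` whose usual lines and parallelism
are those of `A`. -/
def IsUnderlyingField (A : AffineSpace P) (F : Type v) [DivisionRing F] : Prop :=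
  ∃ (V : Type u) (_ : AddCommGroup V) (_ : Module F V) (_ : AddTorsor V P),
    (∀ s : Set P, s ∈ A.lines ↔ ∃ (p : P) (x : V), x ≠ 0 ∧ s = vectorLine F p x) ∧
    (∀ l m : A.lines, A.Parallel l m ↔
      ∃ (p q : P) (x : V), x ≠ 0 ∧ l.1 = vectorLine F p x ∧ m.1 = vectorLine F q x)

/-- A collineation: a bijection preserving collinearity and non-collinearity of points. -/
def IsCollineation (A : AffineSpace P) (A' : AffineSpace P') (f : P → P') : Prop :=
  Function.Bijective f ∧
    ∀ x y z : P, A.Collinear x y z ↔ A'.Collinear (f x) (f y) (f z)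

/-- The point map `f` is given by `a ∩ b ↦ φ a ∩ φ b` for distinct intersecting lines `a`, `b`. -/
def IsInducedBy (A : AffineSpace P) (A' : AffineSpace P') (φ : A.lines → A'.lines)
    (f : P → P') : Prop :=
  ∀ a b : A.lines, a ≠ b → ∀ Q : P, Q ∈ a.1 ∩ b.1 → (φ a).1 ∩ (φ b).1 = {f Q}

end AffineSpace

/-! ### Incidence and parallels -/

namespace AffineSpace

variable {P : Type u} (A : AffineSpace P)

/-! The images of the lines through a point `Q` meet pairwise, so they are concurrent or coplanar.
They cannot all lie in a proper subspace `S` containing a line: some line of `A'` misses `S`, yet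
its preimage is joined to `Q`, so it would meet `S` (`exists_mem_not_image_subset`). As `dim A' ≥
3`, concurrency remains and defines the point map (`exists_common_point`). This map is injective and
preserves and reflects incidence (`isLineEmbedding_of_mem`), so it is a collineation as soon as it
is surjective.

Surjectivity is the real issue, since parallel lines may have images that meet outside the range. In
the finite case, counting points along the lines through a missing point and through an image point
gives different totals. If `dim A ≤ dim A' < ∞`, exchange shows that the preimage of an image plane
is a plane; a missing point there would give two non-meeting lines through one point, against
Euclid's axiom. If lines of `A'` have two points, both are images.

Over fields, points are lifted to vectors with first coordinate one. Images of parallel lines are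
then concurrent in the projective closure, and coordinates along a line produce a monomorphism `F →
F'` (`exists_ringHom`). When it is surjective, the common point of such a pencil must be at
infinity, and lines are mapped onto lines. -/

theorem line_ext {l m : A.lines} {x y : P} (hxy : x ≠ y) (hxl : x ∈ l.1) (hyl : y ∈ l.1)
    (hxm : x ∈ m.1) (hym : y ∈ m.1) : l = m :=
  (A.existsUnique_line x y hxy).unique ⟨hxl, hyl⟩ ⟨hxm, hym⟩

theorem exists_join {x y : P} (hxy : x ≠ y) : ∃ l : A.lines, x ∈ l.1 ∧ y ∈ l.1 :=
  (A.existsUnique_line x y hxy).exists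

theorem exists_ne_mem (l : A.lines) (x : P) : ∃ y ∈ l.1, y ≠ x :=
  (A.line_nontrivial l).exists_ne x

theorem exists_mem (l : A.lines) : ∃ y, y ∈ l.1 := (A.line_nontrivial l).nonempty

variable {A}

theorem Parallel.refl (l : A.lines) : A.Parallel l l := A.parallel_equivalence.refl l

theorem Parallel.symm {l m : A.lines} (h : A.Parallel l m) : A.Parallel m l :=
  A.parallel_equivalence.symm h

theorem Parallel.trans {l m n : A.lines} (h : A.Parallel l m) (h' : A.Parallel m n) :
    A.Parallel l n :=
  A.parallel_equivalence.trans h h'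

theorem Parallel.eq {l m : A.lines} {x : P} (h : A.Parallel l m) (hl : x ∈ l.1) (hm : x ∈ m.1) :
    l = m :=
  (A.existsUnique_parallel x m).unique ⟨hl, h⟩ ⟨hm, Parallel.refl m⟩

variable (A)

/-- The parallel to `l` through `x`. -/
noncomputable def par (x : P) (l : A.lines) : A.lines := (A.existsUnique_parallel x l).choose

theorem mem_par (x : P) (l : A.lines) : x ∈ (A.par x l).1 :=
  (A.existsUnique_parallel x l).choose_spec.1.1

theorem par_parallel (x : P) (l : A.lines) : A.Parallel (A.par x l) l :=
  (A.existsUnique_parallel x l).choose_spec.1.2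

variable {A}

theorem eq_par {x : P} {l m : A.lines} (hx : x ∈ m.1) (h : A.Parallel m l) : m = A.par x l :=
  (h.trans (A.par_parallel x l).symm).eq hx (A.mem_par x l)

theorem par_eq_of_mem {x y : P} {l : A.lines} (h : x ∈ (A.par y l).1) :
    A.par y l = A.par x l :=
  eq_par h (A.par_parallel y l)

theorem mem_par_comm {x y : P} {l : A.lines} (h : x ∈ (A.par y l).1) : y ∈ (A.par x l).1 :=
  par_eq_of_mem h ▸ A.mem_par y l

theorem par_congr {x : P} {l m : A.lines} (h : A.Parallel l m) : A.par x l = A.par x m :=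
  eq_par (A.mem_par x l) ((A.par_parallel x l).trans h)

/-- Completion of a parallelogram. -/
theorem exists_parallelogram {a b c : P} {u v : A.lines} (huv : u ≠ v) (hau : a ∈ u.1)
    (hav : a ∈ v.1) (hb : b ∈ u.1) (hc : c ∈ v.1) :
    ∃ d, d ∈ (A.par b v).1 ∧ d ∈ (A.par c u).1 := by
  rcases eq_or_ne a b with rfl | hab
  · exact ⟨c, by rwa [← eq_par hav (Parallel.refl _)], A.mem_par c u⟩
  rcases eq_or_ne a c with rfl | hac
  · exact ⟨b, A.mem_par b v, by rwa [← eq_par hau (Parallel.refl _)]⟩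
  have hcu : c ∉ u.1 := fun h => huv (A.line_ext hac hau h hav hc)
  have hbc : b ≠ c := fun h => hcu (h ▸ hb)
  obtain ⟨w, hbw, hcw⟩ := A.exists_join hbc
  have haw : a ∉ w.1 := fun h => hcu (A.line_ext hab h hbw hau hb ▸ hcw)
  -- The triangle axiom is used with the ends of the base `b`, `c` interchanged (a half-turn); the
  -- new apex is the fourth vertex.
  obtain ⟨d, v', w', h1, h2, h3, h4, h5, h6⟩ :=
    A.triangle b c a c b w v u w hbc hbw hcw haw hc hav hb hau hbc.symm hcw hbw (Parallel.refl w)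
  exact ⟨d, eq_par h1 h3 ▸ h2, eq_par h4 h6 ▸ h5⟩

/-- Projection of one parallel line to another in a direction in which some point projects. -/
theorem exists_proj_of_parallel {l m d : A.lines} (hlm : A.Parallel l m) {y s z : P}
    (hy : y ∈ m.1) (hs : s ∈ l.1) (hsy : s ∈ (A.par y d).1) (hz : z ∈ m.1) :
    ∃ t ∈ l.1, t ∈ (A.par z d).1 := by
  by_cases h : m = A.par y d
  · refine ⟨s, hs, ?_⟩
    rw [h] at hz
    rwa [← par_eq_of_mem hz]
  · obtain ⟨e, h1, h2⟩ := exists_parallelogram h hy (A.mem_par y d) hz hsy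
    refine ⟨e, ?_, ?_⟩
    · rwa [← eq_par hs hlm] at h2
    · rwa [par_congr (A.par_parallel y d)] at h1

/-- A line of the plane through the line `a` and the point `r`, passing through `r`, is parallel
to `a` or meets `a`. -/
theorem parallel_or_meet {a b k : A.lines} {p r s t : P} (hpa : p ∈ a.1) (hpk : p ∈ k.1)
    (hrk : r ∈ k.1) (hr : r ∉ a.1) (hrb : r ∈ b.1) (hsb : s ∈ b.1) (hsr : s ≠ r) (hta : t ∈ a.1)
    (ht : t ∈ (A.par s k).1) : A.Parallel b a ∨ ∃ x, x ∈ a.1 ∧ x ∈ b.1 := by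
  by_cases htp : t = p
  · subst htp
    have hsk : s ∈ k.1 := by
      rw [eq_par hpk (Parallel.refl k)]
      exact mem_par_comm ht
    exact Or.inr ⟨t, hta, A.line_ext hsr hsb hrb hsk hrk ▸ hpk⟩
  by_cases hst : s = t
  · exact Or.inr ⟨t, hta, hst ▸ hsb⟩
  have hak : a ≠ k := fun h => hr (h ▸ hrk)
  obtain ⟨e, h1, h2⟩ := exists_parallelogram hak hpa hpk hta hrk
  rw [← par_eq_of_mem ht] at h1
  by_cases hes : e = s
  · subst hes
    left
    rw [A.line_ext hsr hsb hrb h2 (A.mem_par r a)]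
    exact A.par_parallel r a
  right
  have hrn : r ∉ (A.par s k).1 := fun h => by
    have h3 : k = A.par s k := ((A.par_parallel s k).symm).eq hrk h
    exact hak (A.line_ext htp hta hpa (h3 ▸ ht) hpk)
  -- The homothety with centre `s` taking `e` to `t` moves `r` along `b` and carries the parallel
  -- `er` of `a` to `a` itself.
  obtain ⟨x, v', w', h3, h4, h5, h6, h7, h8⟩ :=
    A.triangle s e r s t (A.par s k) (A.par r a) b (A.par s k) (Ne.symm hes) (A.mem_par s k) h1 hrn
      h2 (A.mem_par r a) hsb hrb hst (A.mem_par s k) ht (Parallel.refl _)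
  exact ⟨x, (h5.trans (A.par_parallel r a)).eq h3 hta ▸ h4, h8.eq h6 hsb ▸ h7⟩

/-! ### Subspaces, cylinders, exchange and dimension -/

theorem isSubspace_line (l : A.lines) : A.IsSubspace l.1 := by
  refine ⟨fun m x hx y hy hxy hxm hym => (A.line_ext hxy hx hy hxm hym ▸ Set.Subset.rfl),
    fun k m x hx hk hxm hmk => ?_⟩
  obtain ⟨y, hy⟩ := A.exists_mem k
  obtain ⟨z, hz, hzy⟩ := A.exists_ne_mem k y
  have : k = l := A.line_ext hzy hz hy (hk hz) (hk hy)
  subst this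
  exact hmk.eq hxm hx ▸ Set.Subset.rfl

theorem isSubspace_empty : A.IsSubspace (∅ : Set P) :=
  ⟨fun _ _ hx => hx.elim, fun _ _ _ hx => hx.elim⟩

theorem isSubspace_singleton (p : P) : A.IsSubspace ({p} : Set P) := by
  refine ⟨fun _ x hx y hy hxy => (hxy (hx.trans hy.symm)).elim, fun l m x hx hl => ?_⟩
  obtain ⟨y, hy, hyp⟩ := A.exists_ne_mem l p
  exact (hyp (hl hy)).elim

theorem isSubspace_span (s : Set P) : A.IsSubspace (A.span s) := by
  refine ⟨fun l x hx y hy hxy hxl hyl z hz S hS => ?_, fun l m x hx hl hxm hml z hz S hS => ?_⟩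
  · exact hS.1.1 l x (hx S hS) y (hy S hS) hxy hxl hyl hz
  · exact hS.1.2 l m x (hx S hS) (fun w hw => hl hw S hS) hxm hml hz

theorem subset_span (s : Set P) : s ⊆ A.span s := fun _ hx _ hS => hS.2 hx

theorem span_subset {s S : Set P} (hS : A.IsSubspace S) (h : s ⊆ S) : A.span s ⊆ S :=
  fun _ hx => hx S ⟨hS, h⟩

theorem span_mono {s t : Set P} (h : s ⊆ t) : A.span s ⊆ A.span t :=
  span_subset (isSubspace_span t) (h.trans (subset_span t))

variable (A) in
/-- The union of all lines which are parallel to `d` and meet `T`. -/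
def cylinder (T : Set P) (d : A.lines) : Set P := {y | ∃ t ∈ T, t ∈ (A.par y d).1}

theorem subset_cylinder (T : Set P) (d : A.lines) : T ⊆ A.cylinder T d :=
  fun t ht => ⟨t, ht, A.mem_par t d⟩

theorem mem_cylinder_of_mem {T : Set P} {d : A.lines} {o x : P} (ho : o ∈ T) (hod : o ∈ d.1)
    (hx : x ∈ d.1) : x ∈ A.cylinder T d :=
  ⟨o, ho, eq_par hx (Parallel.refl d) ▸ hod⟩

/-- Projecting along `d` turns `l` into a line `k` of `T`. A triangle on `x`, `y` with sides
parallel to `d` and `k` transfers to any two points of `m`, so `m` projects into the parallel to `k`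
through `t`, which lies in `T`. Both closure properties of a subspace are instances. -/
theorem parallel_subset_cylinder {T : Set P} (hT : A.IsSubspace T) {d l m : A.lines} {x y z : P}
    (hx : x ∈ A.cylinder T d) (hy : y ∈ A.cylinder T d) (hxy : x ≠ y) (hxl : x ∈ l.1)
    (hyl : y ∈ l.1) (hz : z ∈ A.cylinder T d) (hzm : z ∈ m.1) (hml : A.Parallel m l) :
    m.1 ⊆ A.cylinder T d := by
  obtain ⟨t₁, ht₁, hxt⟩ := hx
  obtain ⟨t₂, ht₂, hyt⟩ := hy
  obtain ⟨t, ht, hzt⟩ := hz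
  intro w hw
  by_cases hld : A.Parallel l d
  · refine ⟨t, ht, ?_⟩
    rwa [← eq_par hw (hml.trans hld), eq_par hzm (hml.trans hld)]
  have ht12 : t₁ ≠ t₂ := by
    rintro rfl
    have h1 := mem_par_comm hxt
    have h2 := mem_par_comm hyt
    exact hld (A.line_ext hxy hxl hyl h1 h2 ▸ A.par_parallel t₁ d)
  obtain ⟨k, hk1, hk2⟩ := A.exists_join ht12
  have hkT : k.1 ⊆ T := hT.1 k t₁ ht₁ t₂ ht₂ ht12 hk1 hk2
  have hnT : (A.par t k).1 ⊆ T := hT.2 k _ t ht hkT (A.mem_par t k) (A.par_parallel t k)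
  obtain ⟨e, he1, he2⟩ := exists_proj_of_parallel (A.par_parallel x k) hk1 (A.mem_par x k)
    (mem_par_comm hxt) hk2
  rw [← par_eq_of_mem hyt] at he2
  by_cases hey : e = y
  · subst hey
    have hlk : l = A.par x k := A.line_ext hxy hxl hyl (A.mem_par x k) he1
    have hmk : A.Parallel m k := hml.trans (hlk ▸ A.par_parallel x k)
    obtain ⟨s, hs, hsw⟩ := exists_proj_of_parallel ((A.par_parallel t k).trans hmk.symm) hzm
      (A.mem_par t k) hzt hw
    exact ⟨s, hnT hs, hsw⟩
  have hel : e ∉ l.1 := fun h =>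
    hld (A.line_ext hey h hyl he2 (A.mem_par y d) ▸ A.par_parallel y d)
  rcases eq_or_ne z w with rfl | hzw
  · exact ⟨t, ht, hzt⟩
  obtain ⟨c, v', w', h1, h2, h3, h4, h5, h6⟩ :=
    A.triangle x y e z w l (A.par y d) (A.par x k) m hxy hxl hyl hel (A.mem_par y d) he2
      (A.mem_par x k) he1 hzw hzm hw hml
  have hc1 : c ∈ (A.par w d).1 := eq_par h1 (h3.trans (A.par_parallel y d)) ▸ h2
  obtain ⟨s, hs, hsc⟩ := exists_proj_of_parallel
    ((A.par_parallel t k).trans (h6.trans (A.par_parallel x k)).symm) h4 (A.mem_par t k) hzt h5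
  exact ⟨s, hnT hs, par_eq_of_mem hc1 ▸ hsc⟩

theorem isSubspace_cylinder {T : Set P} (hT : A.IsSubspace T) (d : A.lines) :
    A.IsSubspace (A.cylinder T d) := by
  refine ⟨fun l x hx y hy hxy hxl hyl =>
    parallel_subset_cylinder hT hx hy hxy hxl hyl hx hxl (Parallel.refl l),
    fun l m x hx hl hxm hml => ?_⟩
  obtain ⟨y, hy⟩ := A.exists_mem l
  obtain ⟨z, hz, hzy⟩ := A.exists_ne_mem l y
  exact parallel_subset_cylinder hT (hl hz) (hl hy) hzy hz hy hx hxm hml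

theorem span_insert_subset_cylinder {s : Set P} {d : A.lines} {o x : P} (ho : o ∈ A.span s)
    (hod : o ∈ d.1) (hx : x ∈ d.1) : A.span (insert x s) ⊆ A.cylinder (A.span s) d :=
  span_subset (isSubspace_cylinder (isSubspace_span s) d) (Set.insert_subset
    (mem_cylinder_of_mem ho hod hx) ((subset_span s).trans (subset_cylinder _ d)))

/-- Since `y` lies in the cylinder over the span of `s` in the direction `ox`, its parallel to `ox`
meets that span. So `y` and `s` span this parallel, and then also the line `ox`. -/
theorem mem_span_exchange {s : Set P} {x y : P} (hy : y ∈ A.span (insert x s))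
    (hys : y ∉ A.span s) : x ∈ A.span (insert y s) := by
  rcases s.eq_empty_or_nonempty with rfl | ⟨o, ho⟩
  · have h : y ∈ ({x} : Set P) := span_subset (isSubspace_singleton x) (by simp) hy
    obtain rfl : y = x := h
    exact hy
  have ho' := subset_span (A := A) s ho
  have hxs : x ∉ A.span s := fun h => hys
    (span_subset (isSubspace_span s) (Set.insert_subset h (subset_span s)) hy)
  have hox : o ≠ x := fun h => hxs (h ▸ ho')
  obtain ⟨d, hod, hxd⟩ := A.exists_join hox
  obtain ⟨t, ht, hty⟩ := span_insert_subset_cylinder ho' hod hxd hy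
  have hsub : A.span s ⊆ A.span (insert y s) := span_mono (Set.subset_insert y s)
  have hyy : y ∈ A.span (insert y s) := subset_span _ (Set.mem_insert y s)
  have hty' : t ≠ y := fun h => hys (h ▸ ht)
  have h1 := (isSubspace_span (A := A) (insert y s)).1 _ t (hsub ht) y hyy hty' hty (A.mem_par y d)
  exact (isSubspace_span (A := A) (insert y s)).2 _ d o (hsub ho') h1 hod
    (A.par_parallel y d).symm hxd

/-- Steinitz exchange that keeps the already chosen points `Y`: a maximal `Z` between `Y` and `s`
not spanning `y` leaves out some `g`, and `y` replaces `g`. -/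
theorem exists_spanning_insert {s Y : Set P} (hs : s.Finite) (hspan : A.span s = Set.univ)
    (hY : Y ⊆ s) {y : P} (hy : y ∉ A.span Y) :
    ∃ s' : Set P, s'.Finite ∧ A.span s' = Set.univ ∧ insert y Y ⊆ s' ∧ s'.encard = s.encard := by
  by_cases hys : y ∈ s
  · exact ⟨s, hs, hspan, Set.insert_subset hys hY, rfl⟩
  have hfin : {Z | Y ⊆ Z ∧ Z ⊆ s ∧ y ∉ A.span Z}.Finite :=
    hs.finite_subsets.subset fun Z hZ => hZ.2.1
  obtain ⟨Z, hZ⟩ := hfin.exists_maximal ⟨Y, Set.Subset.rfl, hY, hy⟩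
  obtain ⟨⟨hYZ, hZs, hyZ⟩, hmax⟩ := hZ
  have hne : ∃ g ∈ s, g ∉ Z := by
    by_contra! h
    exact hyZ (span_mono (A := A) h (hspan ▸ Set.mem_univ y))
  obtain ⟨g, hgs, hgZ⟩ := hne
  have hyg : y ∈ A.span (insert g Z) := by
    by_contra h
    exact hgZ (hmax ⟨hYZ.trans (Set.subset_insert g Z), Set.insert_subset hgs hZs, h⟩
      (Set.subset_insert g Z) (Set.mem_insert g Z))
  have hg := mem_span_exchange hyg hyZ
  have hZg : Z ⊆ s \ {g} := fun z hz => ⟨hZs hz, fun h => hgZ (h ▸ hz)⟩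
  refine ⟨insert y (s \ {g}), (hs.sdiff).insert y, ?_, Set.insert_subset_insert (hYZ.trans hZg), ?_⟩
  · apply Set.eq_univ_of_univ_subset
    rw [← hspan]
    refine span_subset (isSubspace_span _) fun z hz => ?_
    by_cases hzg : z = g
    · subst hzg
      exact span_mono (Set.insert_subset_insert hZg) hg
    · exact subset_span _ (Set.mem_insert_of_mem _ ⟨hz, hzg⟩)
  · rw [Set.encard_insert_of_notMem (fun h => hys h.1), Set.encard_sdiff_singleton_add_one hgs]

theorem dim_le {s : Set P} {n : ℕ} (hs : s.encard = n + 1) (hspan : A.span s = Set.univ) :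
    A.dim ≤ n :=
  iInf₂_le n ⟨s, hs, hspan⟩

theorem exists_spanning_of_dim_lt_top (h : A.dim < ⊤) :
    ∃ (n : ℕ) (s : Set P), A.dim = n ∧ s.encard = n + 1 ∧ A.span s = Set.univ := by
  set X := {n : ℕ | ∃ s : Set P, s.encard = n + 1 ∧ A.span s = Set.univ} with hX
  have hdim : A.dim = sInf ((fun n : ℕ => (n : ℕ∞)) '' X) := by
    rw [sInf_image]; rfl
  have hne : X.Nonempty := by
    by_contra h'
    rw [Set.not_nonempty_iff_eq_empty] at h'
    rw [hdim, h'] at h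
    simp at h
  obtain ⟨n, ⟨s, hs, hspan⟩, hn⟩ := csInf_mem (hne.image (fun n : ℕ => (n : ℕ∞)))
  exact ⟨n, s, hdim.trans hn.symm, hs, hspan⟩

theorem finite_span {s : Set P} (hs : s.Finite) (hl : ∀ l : A.lines, l.1.Finite) :
    (A.span s).Finite := by
  induction s, hs using Set.Finite.induction_on with
  | empty => exact Set.finite_empty.subset (span_subset isSubspace_empty Set.Subset.rfl)
  | @insert x s _ _ ih =>
    rcases s.eq_empty_or_nonempty with rfl | ⟨o, ho⟩
    · exact (Set.finite_singleton x).subset (span_subset (isSubspace_singleton x) (by simp))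
    have ho' := subset_span (A := A) s ho
    by_cases hox : o = x
    · subst hox
      rwa [Set.insert_eq_of_mem ho]
    obtain ⟨d, hod, hxd⟩ := A.exists_join hox
    refine (ih.biUnion fun t _ => hl (A.par t d)).subset fun y hy => ?_
    obtain ⟨t, ht, hty⟩ := span_insert_subset_cylinder ho' hod hxd hy
    exact Set.mem_biUnion ht (mem_par_comm hty)

/-- Parallel projection of `l` to `m` along the line `pq` is injective; the triangle axiom provides
the image points. -/
theorem mk_line_le_of_mem {l m : A.lines} {o : P} (hol : o ∈ l.1) (hom : o ∈ m.1) :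
    Cardinal.mk l.1 ≤ Cardinal.mk m.1 := by
  by_cases hlm : l = m
  · rw [hlm]
  obtain ⟨p, hp, hpo⟩ := A.exists_ne_mem l o
  obtain ⟨q, hq, hqo⟩ := A.exists_ne_mem m o
  have hql : q ∉ l.1 := fun h => hlm (A.line_ext hqo h hol hq hom)
  have hpq : p ≠ q := fun h => hql (h ▸ hp)
  obtain ⟨d, hpd, hqd⟩ := A.exists_join hpq
  have key : ∀ x : l.1, ∃ y : m.1, (y : P) ∈ (A.par x d).1 := by
    rintro ⟨x, hx⟩
    rcases eq_or_ne o x with rfl | hox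
    · exact ⟨⟨o, hom⟩, A.mem_par o d⟩
    obtain ⟨c, v', w', h1, h2, h3, h4, h5, h6⟩ :=
      A.triangle o p q o x l d m l hpo.symm hol hp hql hpd hqd hom hq hox hol hx (Parallel.refl l)
    exact ⟨⟨c, h6.eq h4 hom ▸ h5⟩, eq_par h1 h3 ▸ h2⟩
  choose f hf using key
  refine Cardinal.mk_le_of_injective (f := f) fun x y hxy => ?_
  by_contra hne
  have h1 := mem_par_comm (hf x)
  have h2 := mem_par_comm (hf y)
  rw [← hxy] at h2
  have h3 : l = _ := A.line_ext (fun h => hne (Subtype.ext h)) x.2 y.2 h1 h2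
  have h4 : A.Parallel l d := h3 ▸ A.par_parallel _ d
  exact hql (h4.eq hp hpd ▸ hqd)

theorem mk_line_le (l m : A.lines) : Cardinal.mk l.1 ≤ Cardinal.mk m.1 := by
  obtain ⟨x, hx⟩ := A.exists_mem l
  obtain ⟨y, hy⟩ := A.exists_mem m
  rcases eq_or_ne x y with rfl | hxy
  · exact mk_line_le_of_mem hx hy
  obtain ⟨n, hxn, hyn⟩ := A.exists_join hxy
  exact (mk_line_le_of_mem hx hxn).trans (mk_line_le_of_mem hyn hy)

theorem mk_line_eq (l m : A.lines) : Cardinal.mk l.1 = Cardinal.mk m.1 :=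
  (mk_line_le l m).antisymm (mk_line_le m l)

/-- If every line has at least three points, then a set of points which is closed under joining
is a subspace. -/
theorem isSubspace_of_join_subset (h3 : ∀ (l : A.lines) (x y : P), ∃ z ∈ l.1, z ≠ x ∧ z ≠ y)
    {S : Set P} (hS : ∀ l : A.lines, ∀ x ∈ S, ∀ y ∈ S, x ≠ y → x ∈ l.1 → y ∈ l.1 → l.1 ⊆ S) :
    A.IsSubspace S := by
  refine ⟨hS, fun l m x hxS hl hxm hml q hq => ?_⟩
  by_cases hxl : x ∈ l.1
  · exact hl (hml.eq hxm hxl ▸ hq)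
  rcases eq_or_ne x q with rfl | hxq
  · exact hxS
  obtain ⟨o, ho⟩ := A.exists_mem l
  have hox : o ≠ x := fun h => hxl (h ▸ ho)
  obtain ⟨k, hok, hxk⟩ := A.exists_join hox
  have hkS := hS k o (hl ho) x hxS hox hok hxk
  obtain ⟨z, hz, hzq⟩ := exists_proj_of_parallel (d := k) hml.symm hxm ho
    (eq_par hxk (Parallel.refl k) ▸ hok) hq
  obtain ⟨y, hy, hyo, hyz⟩ := h3 l o z
  have hql : q ∉ l.1 := fun h => hxl (hml.eq hq h ▸ hxm)
  have hqy : q ≠ y := fun h => hql (h ▸ hy)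
  obtain ⟨n, hqn, hyn⟩ := A.exists_join hqy
  -- The homothety with centre `y` taking `z` to `o` sends `q` to a point `w` of `k`, so `q` is on
  -- the join of `w` and `y`, both in `S`.
  obtain ⟨w, v', w', e1, e2, e3, e4, e5, e6⟩ :=
    A.triangle y z q y o l (A.par q k) n l hyz hy hz hql hzq (A.mem_par q k) hyn hqn hyo hy ho
      (Parallel.refl l)
  have hwk : w ∈ k.1 := (e3.trans (A.par_parallel q k)).eq e1 hok ▸ e2
  have hwn : w ∈ n.1 := e6.eq e4 hyn ▸ e5
  have hwy : w ≠ y := by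
    rintro rfl
    exact hxl (A.line_ext hyo hwk hok hy ho ▸ hxk)
  exact hS n w (hkS hwk) y (hl hy) hwy hwn hyn hqn

theorem span_pair_ne_univ (hdim : 3 ≤ A.dim) {x y : P} (hxy : x ≠ y) :
    A.span {x, y} ≠ Set.univ := fun h => by
  have := hdim.trans (dim_le (n := 1) (by rw [Set.encard_pair hxy]; norm_num) h)
  exact absurd this (by decide)

theorem span_triple_ne_univ (hdim : 3 ≤ A.dim) {x y z : P} (hxy : x ≠ y) (hxz : x ≠ z)
    (hyz : y ≠ z) : A.span {x, y, z} ≠ Set.univ := fun h => by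
  have h3 : ({x, y, z} : Set P).encard = (2 : ℕ) + 1 := by
    rw [Set.encard_eq_three.2 ⟨x, y, z, hxy, hxz, hyz, rfl⟩]; norm_num
  have := hdim.trans (dim_le h3 h)
  exact absurd this (by decide)

theorem line_ne_univ (hdim : 3 ≤ A.dim) (l : A.lines) : l.1 ≠ Set.univ := fun h => by
  obtain ⟨x, hx⟩ := A.exists_mem l
  obtain ⟨y, hy, hyx⟩ := A.exists_ne_mem l x
  refine span_pair_ne_univ hdim hyx (Set.eq_univ_of_univ_subset ?_)
  rw [← h]
  exact (isSubspace_span (A := A) {y, x}).1 l y (subset_span _ (by simp)) x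
    (subset_span _ (by simp)) hyx hy hx

/-- A proper subspace containing a line is disjoint from some line. -/
theorem exists_disjoint_line {S : Set P} (hS : A.IsSubspace S) (hne : S ≠ Set.univ) {l : A.lines}
    (hl : l.1 ⊆ S) : ∃ m : A.lines, ∀ x ∈ m.1, x ∉ S := by
  obtain ⟨x, hx⟩ := (Set.ne_univ_iff_exists_notMem S).1 hne
  refine ⟨A.par x l, fun y hy hyS => hx ?_⟩
  exact hS.2 l _ y hyS hl hy (A.par_parallel x l) (A.mem_par x l)

end AffineSpace
-- The induced point map
namespace AffineSpace

variable {P : Type u} {P' : Type u'} {A : AffineSpace P} {A' : AffineSpace P'}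
  {φ : A.lines → A'.lines} {f : P → P'}

theorem exists_line (hdim : 3 ≤ A.dim) : Nonempty A.lines := by
  by_contra h
  obtain ⟨x⟩ := A.nonempty
  have hu : A.span {x} = Set.univ := by
    refine Set.eq_univ_of_forall fun y => ?_
    by_contra hy
    have hxy : x ≠ y := fun e => hy (subset_span (A := A) _ e.symm)
    exact h (A.exists_join hxy).nonempty
  have := hdim.trans (dim_le (n := 0) (by simp) hu)
  exact absurd this (by decide)

/-- Otherwise take a line missing `S`; joining `Q` to a point of its preimage gives a line whose
image is in `S` and meets it. -/
theorem exists_mem_not_image_subset (hφ : Function.Surjective φ)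
    (hrel : ∀ a b : A.lines, A.Related a b → A'.Related (φ a) (φ b)) {S : Set P'}
    (hS : A'.IsSubspace S) (hne : S ≠ Set.univ) {l : A'.lines} (hl : l.1 ⊆ S) (Q : P) :
    ∃ a : A.lines, Q ∈ a.1 ∧ ¬ (φ a).1 ⊆ S := by
  by_contra! h
  obtain ⟨m', hm'⟩ := exists_disjoint_line hS hne hl
  obtain ⟨m, rfl⟩ := hφ m'
  obtain ⟨x, hx⟩ := A.exists_mem m
  by_cases hxQ : x = Q
  · subst hxQ
    obtain ⟨y, hy⟩ := A'.exists_mem (φ m)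
    exact hm' y hy (h m hx hy)
  · obtain ⟨k, hxk, hQk⟩ := A.exists_join hxQ
    obtain ⟨y, hyk, hym⟩ := hrel k m ⟨x, hxk, hx⟩
    exact hm' y hym (h k hQk hyk)

/-- The images of the lines through a point are concurrent. -/
theorem exists_common_point (hdim : 3 ≤ A'.dim) (hφ : Function.Surjective φ)
    (hrel : ∀ a b : A.lines, A.Related a b → A'.Related (φ a) (φ b)) (Q : P) :
    ∃ R : P', ∀ a : A.lines, Q ∈ a.1 → R ∈ (φ a).1 := by
  obtain ⟨l⟩ := exists_line hdim
  obtain ⟨a, hQa, -⟩ : ∃ a : A.lines, Q ∈ a.1 ∧ ¬ (φ a).1 ⊆ l.1 :=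
    exists_mem_not_image_subset hφ hrel (isSubspace_line l) (line_ne_univ hdim l)
      Set.Subset.rfl Q
  obtain ⟨b, hQb, hb⟩ := exists_mem_not_image_subset hφ hrel (isSubspace_line (φ a))
    (line_ne_univ hdim _) Set.Subset.rfl Q
  have hab : φ a ≠ φ b := fun h => hb (h ▸ Set.Subset.rfl)
  obtain ⟨R, hRa, hRb⟩ := hrel a b ⟨Q, hQa, hQb⟩
  refine ⟨R, fun c hQc => ?_⟩
  by_contra hRc
  obtain ⟨x, hxa, hxc⟩ := hrel a c ⟨Q, hQa, hQc⟩
  obtain ⟨y, hyb, hyc⟩ := hrel b c ⟨Q, hQb, hQc⟩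
  have hxR : R ≠ x := fun h => hRc (h ▸ hxc)
  have hyR : R ≠ y := fun h => hRc (h ▸ hyc)
  have hxy : x ≠ y := fun h => hab (A'.line_ext hxR hRa hxa hRb (h ▸ hyb))
  -- If the image of `c` misses `R`, the three images form a triangle, and every further line
  -- meeting all of them lies in its plane.
  set S := A'.span {R, x, y} with hSdef
  have hS : A'.IsSubspace S := isSubspace_span _
  have hRS : R ∈ S := subset_span _ (by simp)
  have hxS : x ∈ S := subset_span _ (by simp)
  have hyS : y ∈ S := subset_span _ (by simp)
  have ha : (φ a).1 ⊆ S := hS.1 _ R hRS x hxS hxR hRa hxa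
  have hb : (φ b).1 ⊆ S := hS.1 _ R hRS y hyS hyR hRb hyb
  have hc : (φ c).1 ⊆ S := hS.1 _ x hxS y hyS hxy hxc hyc
  obtain ⟨d, hQd, hd⟩ := exists_mem_not_image_subset hφ hrel hS
    (span_triple_ne_univ hdim hxR hyR hxy) ha Q
  refine hd ?_
  by_cases hRd : R ∈ (φ d).1
  · obtain ⟨z, hzd, hzc⟩ := hrel d c ⟨Q, hQd, hQc⟩
    exact hS.1 _ R hRS z (hc hzc) (fun h => hRc (h ▸ hzc)) hRd hzd
  · obtain ⟨z, hzd, hza⟩ := hrel d a ⟨Q, hQd, hQa⟩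
    obtain ⟨w, hwd, hwb⟩ := hrel d b ⟨Q, hQd, hQb⟩
    have hzR : R ≠ z := fun h => hRd (h ▸ hzd)
    refine hS.1 _ z (ha hza) w (hb hwb) (fun h => ?_) hzd hwd
    exact hab (A'.line_ext hzR hRa hza hRb (h ▸ hwb))

theorem exists_ne_line_mem (hdim : 3 ≤ A'.dim) (hφ : Function.Surjective φ)
    (hrel : ∀ a b : A.lines, A.Related a b → A'.Related (φ a) (φ b)) (Q : P) (a : A.lines) :
    ∃ b : A.lines, Q ∈ b.1 ∧ a ≠ b := by
  obtain ⟨b, hb, h⟩ := exists_mem_not_image_subset hφ hrel (isSubspace_line (φ a))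
    (line_ne_univ hdim _) Set.Subset.rfl Q
  exact ⟨b, hb, fun e => h (e ▸ Set.Subset.rfl)⟩

theorem isInducedBy_of_mem (hφ : Function.Injective φ) (hf : ∀ a : A.lines, ∀ x ∈ a.1, f x ∈ (φ a).1) :
    A.IsInducedBy A' φ f := by
  intro a b hab Q hQ
  refine Set.Subset.antisymm (fun y hy => ?_) (Set.singleton_subset_iff.2 ⟨hf a Q hQ.1, hf b Q hQ.2⟩)
  by_contra hne
  exact hab (hφ (A'.line_ext hne hy.1 (hf a Q hQ.1) hy.2 (hf b Q hQ.2)))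

theorem IsInducedBy.mem (hf : A.IsInducedBy A' φ f)
    (hstar : ∀ (Q : P) (a : A.lines), ∃ b : A.lines, Q ∈ b.1 ∧ a ≠ b) (a : A.lines) (x : P)
    (hx : x ∈ a.1) : f x ∈ (φ a).1 := by
  obtain ⟨b, hxb, hab⟩ := hstar x a
  have h := hf a b hab x ⟨hx, hxb⟩
  exact (h ▸ Set.mem_singleton (f x) : f x ∈ (φ a).1 ∩ (φ b).1).1

theorem existsUnique_isInducedBy (hdim : 3 ≤ A'.dim) (hφ : Function.Bijective φ)
    (hrel : ∀ a b : A.lines, A.Related a b → A'.Related (φ a) (φ b)) :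
    ∃! f : P → P', A.IsInducedBy A' φ f := by
  choose f hf using exists_common_point hdim hφ.2 hrel
  refine ⟨f, isInducedBy_of_mem hφ.1 fun a x hx => hf x a hx, fun g hg => funext fun x => ?_⟩
  have hstar := exists_ne_line_mem hdim hφ.2 hrel
  obtain ⟨l'⟩ := exists_line hdim
  obtain ⟨l, -⟩ := hφ.2 l'
  obtain ⟨a, hxa, -⟩ := hstar x l
  obtain ⟨b, hxb, hab⟩ := hstar x a
  have h : f x ∈ (φ a).1 ∩ (φ b).1 := ⟨hf x a hxa, hf x b hxb⟩
  rw [hg a b hab x ⟨hxa, hxb⟩] at h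
  exact h.symm

/-- An injective point map `f` which is compatible with the surjective line map `φ`, in the sense
that `f` preserves and reflects incidence. -/
structure IsLineEmbedding (A : AffineSpace P) (A' : AffineSpace P') (φ : A.lines → A'.lines)
    (f : P → P') : Prop where
  surjective : Function.Surjective φ
  injective : Function.Injective f
  mem_iff : ∀ (a : A.lines) (x : P), x ∈ a.1 ↔ f x ∈ (φ a).1

/-- If `f x = f y`, every `z` off the line `xy` is the meet of two lines whose distinct images share
`f x`, so `f z = f x`. Then all lines of `A'` pass through `f x`, although disjoint lines exist. -/
theorem injective_of_mem (hdim : 3 ≤ A'.dim) (hφ : Function.Bijective φ)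
    (hf : ∀ a : A.lines, ∀ x ∈ a.1, f x ∈ (φ a).1) : Function.Injective f := by
  intro x y hxy
  by_contra hne
  obtain ⟨c, hxc, hyc⟩ := A.exists_join hne
  have hoff : ∀ z, z ∉ c.1 → f z = f x := by
    intro z hz
    have hzx : z ≠ x := fun h => hz (h ▸ hxc)
    have hzy : z ≠ y := fun h => hz (h ▸ hyc)
    obtain ⟨a, hza, hxa⟩ := A.exists_join hzx
    obtain ⟨b, hzb, hyb⟩ := A.exists_join hzy
    by_contra h
    have hab : a = b := hφ.1 (A'.line_ext h (hf a z hza) (hf a x hxa) (hf b z hzb)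
      (hxy ▸ hf b y hyb))
    subst hab
    exact hz (A.line_ext hne hxa hyb hxc hyc ▸ hza)
  have hall : ∀ a' : A'.lines, f x ∈ a'.1 := by
    intro a'
    obtain ⟨a, rfl⟩ := hφ.2 a'
    by_cases hac : a = c
    · subst hac
      exact hf a x hxc
    · obtain ⟨z, hza, hzc⟩ : ∃ z ∈ a.1, z ∉ c.1 := by
        by_contra! h
        obtain ⟨z, hz⟩ := A.exists_mem a
        obtain ⟨w, hw, hwz⟩ := A.exists_ne_mem a z
        exact hac (A.line_ext hwz hw hz (h w hw) (h z hz))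
      exact hoff z hzc ▸ hf a z hza
  obtain ⟨l⟩ := exists_line hdim
  obtain ⟨m, hm⟩ := exists_disjoint_line (isSubspace_line l) (line_ne_univ hdim l) Set.Subset.rfl
  exact hm _ (hall m) (hall l)

theorem isLineEmbedding_of_mem (hdim : 3 ≤ A'.dim) (hφ : Function.Bijective φ)
    (hf : ∀ a : A.lines, ∀ x ∈ a.1, f x ∈ (φ a).1) : A.IsLineEmbedding A' φ f := by
  have hinj := injective_of_mem hdim hφ hf
  refine ⟨hφ.2, hinj, fun a x => ⟨hf a x, fun hx => ?_⟩⟩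
  obtain ⟨y, hya, hyx⟩ := A.exists_ne_mem a x
  obtain ⟨b, hyb, hxb⟩ := A.exists_join hyx
  rwa [hφ.1 (A'.line_ext (hinj.ne hyx) (hf a y hya) hx (hf b y hyb) (hf b x hxb))]

/-! ### Surjectivity by counting, by dimension and in order two -/

namespace IsLineEmbedding

variable (h : A.IsLineEmbedding A' φ f)
include h

theorem isCollineation (hsurj : Function.Surjective f) : A.IsCollineation A' f := by
  refine ⟨⟨h.injective, hsurj⟩, fun x y z => ⟨?_, ?_⟩⟩
  · rintro ⟨l, hl, hx, hy, hz⟩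
    exact ⟨_, (φ ⟨l, hl⟩).2, (h.mem_iff ⟨l, hl⟩ x).1 hx, (h.mem_iff ⟨l, hl⟩ y).1 hy,
      (h.mem_iff ⟨l, hl⟩ z).1 hz⟩
  · rintro ⟨l, hl, hx, hy, hz⟩
    obtain ⟨a, ha⟩ := h.surjective ⟨l, hl⟩
    have e : l = (φ a).1 := by rw [ha]
    subst e
    exact ⟨a.1, a.2, (h.mem_iff a x).2 hx, (h.mem_iff a y).2 hy, (h.mem_iff a z).2 hz⟩

/-- Only joins pull back, as `f` need not respect parallelism; lines of at least three points make
closure under joins sufficient. -/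
theorem isSubspace_preimage (h3 : ∀ (l : A.lines) (x y : P), ∃ z ∈ l.1, z ≠ x ∧ z ≠ y)
    {S : Set P'} (hS : A'.IsSubspace S) : A.IsSubspace (f ⁻¹' S) := by
  refine isSubspace_of_join_subset h3 fun l x hx y hy hxy hxl hyl z hz => ?_
  exact hS.1 (φ l) (f x) hx (f y) hy (h.injective.ne hxy) ((h.mem_iff l x).1 hxl)
    ((h.mem_iff l y).1 hyl) ((h.mem_iff l z).1 hz)

theorem eq_univ_of_range_subset {S : Set P'} (hdim : 3 ≤ A'.dim) (hS : A'.IsSubspace S)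
    (hf : ∀ x, f x ∈ S) : S = Set.univ := by
  obtain ⟨l⟩ := exists_line hdim
  refine Set.eq_univ_of_forall fun x' => ?_
  obtain ⟨a, ha⟩ := h.surjective (A'.par x' l)
  obtain ⟨x, hx⟩ := A.exists_mem a
  obtain ⟨y, hy, hyx⟩ := A.exists_ne_mem a x
  refine hS.1 (φ a) _ (hf y) _ (hf x) (h.injective.ne hyx) ((h.mem_iff a y).1 hy)
    ((h.mem_iff a x).1 hx) ?_
  rw [ha]
  exact A'.mem_par x' l

theorem surjective_of_finite [Finite P] (hφ : Function.Injective φ) (hdim : 3 ≤ A'.dim) :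
    Function.Surjective f := by
  classical
  intro x'
  by_contra hx'
  push Not at hx'
  obtain ⟨y⟩ := A.nonempty
  have hfintype : ∀ z : P', Fintype {a : A.lines // z ∈ (φ a).1} := fun z => Fintype.ofFinite _
  have hstar : ∀ z : P', Nat.card {a : A.lines // z ∈ (φ a).1} =
      Nat.card {a : A.lines // f y ∈ (φ a).1} := by
    intro z
    have key : ∀ z : P', Nat.card {a : A.lines // z ∈ (φ a).1} = Nat.card {l : A'.lines // z ∈ l.1} :=
      fun z => Nat.card_congr ((Equiv.ofBijective φ ⟨hφ, h.surjective⟩).subtypeEquiv fun _ => Iff.rfl)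
    rw [key, key]
    refine Nat.card_congr ⟨fun l => ⟨A'.par (f y) l.1, A'.mem_par _ _⟩,
      fun l => ⟨A'.par z l.1, A'.mem_par _ _⟩, fun l => Subtype.ext ?_, fun l => Subtype.ext ?_⟩
    · exact (eq_par l.2 (A'.par_parallel _ _).symm).symm
    · exact (eq_par l.2 (A'.par_parallel _ _).symm).symm
  obtain ⟨l'⟩ := exists_line hdim
  obtain ⟨l, -⟩ := h.surjective l'
  set n := Nat.card l.1 with hn
  have hline : ∀ a : A.lines, Nat.card a.1 = n := fun a => by
    rw [hn, Nat.card, Nat.card, mk_line_eq a l]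
  -- The preimages of the lines through the missing point `x'` partition `P`.
  have e1 : Nat.card P = Nat.card {a : A.lines // x' ∈ (φ a).1} * n := by
    have e : (Σ a : {a : A.lines // x' ∈ (φ a).1}, a.1.1) ≃ P := by
      refine Equiv.ofBijective (fun p => p.2.1) ⟨?_, fun p => ?_⟩
      · rintro ⟨⟨a, ha⟩, p, hp⟩ ⟨⟨b, hb⟩, q, hq⟩ hpq
        obtain rfl : p = q := hpq
        obtain rfl : a = b := hφ (A'.line_ext (hx' p) ((h.mem_iff a p).1 hp) ha
          ((h.mem_iff b p).1 hq) hb)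
        rfl
      · obtain ⟨k, hk1, hk2⟩ := A'.exists_join (hx' p)
        obtain ⟨a, rfl⟩ := h.surjective k
        exact ⟨⟨⟨a, hk2⟩, p, (h.mem_iff a p).2 hk1⟩, rfl⟩
    rw [← Nat.card_congr e, Nat.card_sigma]
    simp [hline]
  -- The lines through `y` partition the remaining points. With `k` lines through each point of
  -- `A'`, `k n = 1 + k (n - 1)` forces `k = 1`, so `A'` would be a line.
  have e2 : Nat.card P = 1 + Nat.card {a : A.lines // f y ∈ (φ a).1} * (n - 1) := by
    have e : (Σ a : {a : A.lines // f y ∈ (φ a).1}, {p : a.1.1 // p.1 ≠ y}) ≃ {p : P // p ≠ y} := by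
      refine Equiv.ofBijective (fun p => ⟨p.2.1.1, p.2.2⟩) ⟨?_, fun p => ?_⟩
      · rintro ⟨⟨a, ha⟩, ⟨p, hp⟩, hpy⟩ ⟨⟨b, hb⟩, ⟨q, hq⟩, hqy⟩ hpq
        obtain rfl : p = q := congrArg Subtype.val hpq
        obtain rfl : a = b := A.line_ext hpy hp ((h.mem_iff a y).2 ha) hq ((h.mem_iff b y).2 hb)
        rfl
      · obtain ⟨a, hk1, hk2⟩ := A.exists_join p.2
        exact ⟨⟨⟨a, (h.mem_iff a y).1 hk2⟩, ⟨p.1, hk1⟩, p.2⟩, rfl⟩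
    have hone : ∀ (T : Type u) [Finite T] (t : T), Nat.card {s : T // s ≠ t} = Nat.card T - 1 := by
      intro T _ t
      have := Fintype.ofFinite T
      simp [Nat.card_eq_fintype_card, Fintype.card_subtype_compl]
    have e3 := Nat.card_congr e
    rw [Nat.card_sigma, hone] at e3
    have e4 : ∀ a : {a : A.lines // f y ∈ (φ a).1}, Nat.card {p : a.1.1 // p.1 ≠ y} = n - 1 := by
      intro a
      rw [← hline a.1, ← hone a.1.1 ⟨y, (h.mem_iff a.1 y).2 a.2⟩]
      exact Nat.card_congr (Equiv.subtypeEquivRight fun p => by simp [Subtype.ext_iff])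
    simp only [e4, Finset.sum_const, smul_eq_mul] at e3
    have : 0 < Nat.card P := Nat.card_pos_iff.2 ⟨⟨y⟩, inferInstance⟩
    rw [Finset.card_univ, ← Nat.card_eq_fintype_card] at e3
    omega
  rw [e1, hstar] at e2
  have hnpos : 0 < n := by
    obtain ⟨z, hz⟩ := A.exists_mem l
    exact Nat.card_pos_iff.2 ⟨⟨⟨z, hz⟩⟩, inferInstance⟩
  obtain ⟨m, hm⟩ := Nat.exists_eq_add_of_lt hnpos
  have hk : Nat.card {a : A.lines // f y ∈ (φ a).1} = 1 := by
    rw [hm] at e2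
    simp only [zero_add, Nat.add_sub_cancel, mul_add, mul_one] at e2
    omega
  have hsub := (Nat.card_eq_one_iff_unique.1 hk).1
  refine line_ne_univ hdim (A'.par (f y) l') ?_
  refine Set.eq_univ_of_forall fun z => ?_
  by_cases hz : f y = z
  · exact hz ▸ A'.mem_par _ _
  obtain ⟨k, hk1, hk2⟩ := A'.exists_join hz
  obtain ⟨a, ha⟩ := h.surjective k
  obtain ⟨b, hb⟩ := h.surjective (A'.par (f y) l')
  have : (⟨a, ha ▸ hk1⟩ : {a : A.lines // f y ∈ (φ a).1}) = ⟨b, hb ▸ A'.mem_par _ _⟩ :=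
    Subsingleton.elim _ _
  obtain rfl : a = b := congrArg Subtype.val this
  rw [← hb, ha]
  exact hk2

/-- If the preimage of a plane is contained in a plane, then the former plane belongs to the
range. -/
theorem mem_range_of_preimage_subset_cylinder {a k : A.lines} {p r : P} (hpa : p ∈ a.1)
    (hpk : p ∈ k.1) (hrk : r ∈ k.1) (hra : r ∉ a.1) {S : Set P'} (hS : A'.IsSubspace S)
    (haS : (φ a).1 ⊆ S) (hrS : f r ∈ S) (hpre : f ⁻¹' S ⊆ A.cylinder a.1 k) {x' : P'}
    (hx' : x' ∈ (φ a).1) : x' ∈ Set.range f := by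
  by_contra hx
  have hne : ∀ y, f y ≠ x' := fun y hy => hx ⟨y, hy⟩
  have hra' : f r ∉ (φ a).1 := fun e => hra ((h.mem_iff a r).2 e)
  -- It applies to the preimages of two lines through `f r`: the parallel to `φ a`, and the join
  -- with the missing point `x'`. Neither preimage meets `a`, so they coincide, which is absurd.
  have key : ∀ b : A.lines, r ∈ b.1 → (φ b).1 ⊆ S → (∀ x ∈ a.1, x ∉ b.1) → A.Parallel b a := by
    intro b hrb hbS hdisj
    obtain ⟨s, hsb, hsr⟩ := A.exists_ne_mem b r
    obtain ⟨t, hta, ht⟩ := hpre (hbS ((h.mem_iff b s).1 hsb))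
    refine (parallel_or_meet hpa hpk hrk hra hrb hsb hsr hta ht).resolve_right ?_
    rintro ⟨x, hxa, hxb⟩
    exact hdisj x hxa hxb
  obtain ⟨b, hb⟩ := h.surjective (A'.par (f r) (φ a))
  have hb' : f r ∈ (φ b).1 := hb ▸ A'.mem_par _ _
  have hba : A'.Parallel (φ b) (φ a) := hb ▸ A'.par_parallel _ _
  have hpb := key b ((h.mem_iff b r).2 hb') (hS.2 _ _ _ hrS haS hb' hba) fun x hxa hxb =>
    hra' (hba.eq ((h.mem_iff b x).1 hxb) ((h.mem_iff a x).1 hxa) ▸ hb')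
  obtain ⟨c', hc1, hc2⟩ := A'.exists_join (hne r)
  obtain ⟨c, rfl⟩ := h.surjective c'
  have hpc := key c ((h.mem_iff c r).2 hc1) (hS.1 _ _ hrS _ (haS hx') (hne r) hc1 hc2)
    fun x hxa hxc => hra' (A'.line_ext (hne x) ((h.mem_iff c x).1 hxc) hc2
      ((h.mem_iff a x).1 hxa) hx' ▸ hc1)
  have hbc : b = c := (hpb.trans hpc.symm).eq ((h.mem_iff b r).2 hb') ((h.mem_iff c r).2 hc1)
  subst hbc
  exact hra' (hba.eq hc2 hx' ▸ hc1)

theorem surjective_of_dim_le (hφ : Function.Injective φ) (hdim : 3 ≤ A'.dim)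
    (hle : A.dim ≤ A'.dim) (hfin : A'.dim < ⊤) : Function.Surjective f := by
  obtain ⟨n, B, hn, hB, hspan⟩ := exists_spanning_of_dim_lt_top (hle.trans_lt hfin)
  have hBfin : B.Finite := Set.encard_lt_top_iff.1 (by rw [hB]; exact ENat.natCast_lt_top (n + 1))
  by_cases h3 : ∀ (l : A.lines) (x y : P), ∃ z ∈ l.1, z ≠ x ∧ z ≠ y
  swap
  -- A line with at most two points makes all lines finite, hence `P` finite.
  · push Not at h3
    obtain ⟨l, x, y, hl⟩ := h3
    have hlfin : l.1.Finite := (Set.toFinite {x, y}).subset fun z hz => by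
      by_cases hzx : z = x
      · exact Or.inl hzx
      · exact Or.inr (hl z hz hzx)
    have hall : ∀ m : A.lines, m.1.Finite := fun m => by
      rw [← Set.finite_coe_iff, ← Cardinal.lt_aleph0_iff_finite, mk_line_eq m l,
        Cardinal.lt_aleph0_iff_finite]
      exact hlfin
    have : Finite P := by
      rw [← Set.finite_univ_iff, ← hspan]
      exact finite_span hBfin hall
    exact h.surjective_of_finite hφ hdim
  intro x'
  obtain ⟨l⟩ := exists_line hdim
  obtain ⟨a, ha⟩ := h.surjective (A'.par x' l)
  have hx' : x' ∈ (φ a).1 := ha ▸ A'.mem_par x' l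
  obtain ⟨p, hp⟩ := A.exists_mem a
  obtain ⟨q, hq, hqp⟩ := A.exists_ne_mem a p
  obtain ⟨r, hr⟩ : ∃ r, r ∉ a.1 := by
    by_contra! hr
    exact line_ne_univ hdim (φ a) (h.eq_univ_of_range_subset hdim (isSubspace_line _)
      fun x => (h.mem_iff a x).1 (hr x))
  have hpr : p ≠ r := fun e => hr (e ▸ hp)
  obtain ⟨k, hpk, hrk⟩ := A.exists_join hpr
  set S := A'.span (f '' {r, q, p}) with hSdef
  have hS : A'.IsSubspace S := isSubspace_span _
  have hfS : ∀ z ∈ ({r, q, p} : Set P), f z ∈ S := fun z hz => subset_span _ ⟨z, hz, rfl⟩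
  have haS : (φ a).1 ⊆ S := hS.1 _ _ (hfS q (by simp)) _ (hfS p (by simp)) (h.injective.ne hqp)
    ((h.mem_iff a q).1 hq) ((h.mem_iff a p).1 hp)
  refine h.mem_range_of_preimage_subset_cylinder hp hpk hrk hr hS haS (hfS r (by simp)) ?_ hx'
  have hpqa : A.span {q, p} ⊆ a.1 :=
    span_subset (isSubspace_line a) (Set.insert_subset hq (Set.singleton_subset_iff.2 hp))
  have hcyl : A.span {r, q, p} ⊆ A.cylinder a.1 k :=
    span_subset (isSubspace_cylinder (isSubspace_line a) k)
      (Set.insert_subset (mem_cylinder_of_mem hp hpk hrk)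
        (((subset_span (A := A) _).trans hpqa).trans (subset_cylinder _ k)))
  refine fun y hy => hcyl ?_
  -- Let `y` be outside the plane of `p`, `q`, `r` but `f y` in `S`. Exchange puts all four points
  -- into a spanning set of `n + 1` points; the images of the `n` points other than `y` already span
  -- `A'`, so `dim A' ≤ n - 1`.
  by_contra hyE
  obtain ⟨B₁, f₁, s₁, i₁, c₁⟩ := exists_spanning_insert (y := p) hBfin hspan (Set.empty_subset B)
    (fun e => span_subset isSubspace_empty Set.Subset.rfl e)
  obtain ⟨B₂, f₂, s₂, i₂, c₂⟩ := exists_spanning_insert (y := q) f₁ s₁ i₁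
    (fun e => hqp (span_subset (isSubspace_singleton p) (by simp) e))
  obtain ⟨B₃, f₃, s₃, i₃, c₃⟩ := exists_spanning_insert (y := r) f₂ s₂ i₂
    (fun e => hr (hpqa (by simpa using e)))
  obtain ⟨B₄, f₄, s₄, i₄, c₄⟩ := exists_spanning_insert (y := y) f₃ s₃ i₃ (by simpa using hyE)
  have hyB : y ∈ B₄ := i₄ (Set.mem_insert _ _)
  have hyT : y ∉ ({r, q, p} : Set P) := fun e => hyE (subset_span _ e)
  have hTB : ({r, q, p} : Set P) ⊆ B₄ \ {y} := fun z hz =>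
    ⟨i₄ (Set.mem_insert_of_mem _ (by simpa using hz)), fun e => hyT (e ▸ hz)⟩
  have hcard : (B₄ \ {y}).encard + 1 = n + 1 := by
    rw [Set.encard_sdiff_singleton_add_one hyB, c₄, c₃, c₂, c₁, hB]
  have hcard' : (B₄ \ {y}).encard = n := by
    exact (ENat.add_left_injective_of_ne_top ENat.one_ne_top) hcard
  have hspan' : A'.span (f '' (B₄ \ {y})) = Set.univ := by
    refine h.eq_univ_of_range_subset hdim (isSubspace_span _) fun x => ?_
    have hsub := isSubspace_preimage h h3 (isSubspace_span (A := A') (f '' (B₄ \ {y})))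
    have : A.span B₄ ⊆ f ⁻¹' (A'.span (f '' (B₄ \ {y}))) := by
      refine span_subset hsub fun z hz => ?_
      by_cases hzy : z = y
      · subst hzy
        exact span_mono (Set.image_mono hTB) hy
      · exact subset_span _ ⟨z, ⟨hz, hzy⟩, rfl⟩
    exact this (s₄ ▸ Set.mem_univ x)
  have hn3 : 1 ≤ n := by
    have : (1 : ℕ∞) ≤ n := by
      rw [← hcard', Set.one_le_encard_iff_nonempty]
      exact ⟨p, hTB (by simp)⟩
    exact_mod_cast this
  obtain ⟨m, rfl⟩ := Nat.exists_eq_add_of_le' hn3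
  have h1 := dim_le (n := m) (by rw [h.injective.encard_image, hcard']; norm_cast) hspan'
  have h2 := hle.trans h1
  rw [hn] at h2
  norm_cast at h2
  omega

theorem surjective_of_order_two (hdim : 3 ≤ A'.dim) (h2 : A'.HasOrder 2) :
    Function.Surjective f := by
  intro x'
  obtain ⟨l⟩ := exists_line hdim
  obtain ⟨a, ha⟩ := h.surjective (A'.par x' l)
  have hx' : x' ∈ (φ a).1 := ha ▸ A'.mem_par x' l
  obtain ⟨p, hp⟩ := A.exists_mem a
  obtain ⟨q, hq, hqp⟩ := A.exists_ne_mem a p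
  obtain ⟨x, y, -, hxy⟩ := Cardinal.mk_eq_two_iff.1 (h2 (φ a))
  have hm : ∀ z : (φ a).1, z = x ∨ z = y := fun z => by
    have : z ∈ ({x, y} : Set (φ a).1) := hxy ▸ Set.mem_univ z
    exact this
  by_contra! hne
  have hne' : ∀ y, f y ≠ x' := by simpa using hne
  have h1 := hm ⟨_, (h.mem_iff a p).1 hp⟩
  have h2 := hm ⟨_, (h.mem_iff a q).1 hq⟩
  have h3 := hm ⟨_, hx'⟩
  have h4 := h.injective.ne hqp
  have h5 := hne' p
  have h6 := hne' q
  simp only [Subtype.ext_iff] at h1 h2 h3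
  grind

end IsLineEmbedding

end AffineSpace

/-! ### Collinear maps into a projective closure -/

section Lift

variable {F F' V W : Type*} [DivisionRing F] [DivisionRing F'] [AddCommGroup V] [Module F V]
  [AddCommGroup W] [Module F' W]

open Submodule

/-- A map from an affine space over `F` to an affine hyperplane `p = 1` of a vector space over
`F'` which preserves collinearity and whose image is not contained in a plane. -/
structure IsCollinearLift (F : Type*) [DivisionRing F] [Module F V] (p : W →ₗ[F'] F')
    (g : V → W) : Prop where
  map_one : ∀ x, p (g x) = 1
  mem_span : ∀ (x v : V) (t : F), g (x + t • v) ∈ span F' {g x, g (x + v)}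
  exists_notMem : ∀ a b c : W, ∃ x, g x ∉ span F' {a, b, c}
  exists_scalar : ∃ c : F, c ≠ 0 ∧ c ≠ 1

/-- Every vector is a linear combination of the three given ones. -/
def Generates (F : Type*) [DivisionRing F] [Module F V] (v₁ v₂ v₃ : V) : Prop :=
  ∀ x : V, ∃ a b c : F, x = a • v₁ + b • v₂ + c • v₃

theorem Generates.swap_left {v₁ v₂ v₃ : V} (h : Generates F v₁ v₂ v₃) : Generates F v₂ v₁ v₃ :=
  fun x => by
    obtain ⟨a, b, c, rfl⟩ := h x
    exact ⟨b, a, c, by abel⟩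

theorem Generates.swap_right {v₁ v₂ v₃ : V} (h : Generates F v₁ v₂ v₃) : Generates F v₁ v₃ v₂ :=
  fun x => by
    obtain ⟨a, b, c, rfl⟩ := h x
    exact ⟨a, c, b, by abel⟩

theorem Generates.replace {v₁ v₂ v₃ : V} (h : Generates F v₁ v₂ v₃) (a b : F) {c : F}
    (hc : c ≠ 0) : Generates F v₁ v₂ (a • v₁ + b • v₂ + c • v₃) := fun x => by
  obtain ⟨a', b', c', rfl⟩ := h x
  refine ⟨a' - c' * c⁻¹ * a, b' - c' * c⁻¹ * b, c' * c⁻¹, ?_⟩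
  simp only [smul_add, smul_smul, sub_smul, inv_mul_cancel_right₀ hc]
  abel

/-- `w` represents the common point at infinity of the images of the lines in direction `v`. -/
def IsDirection (F' : Type*) [DivisionRing F'] [Module F' W] (g : V → W) (v : V) (w : W) : Prop :=
  w ≠ 0 ∧ ∀ x, w ∈ span F' {g x, g (x + v)}

theorem IsDirection.smul {g : V → W} {v : V} {w : W} (h : IsDirection F' g v w) {c : F'}
    (hc : c ≠ 0) : IsDirection F' g v (c • w) :=
  ⟨smul_ne_zero hc h.1, fun x => smul_mem _ c (h.2 x)⟩

namespace IsCollinearLift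

variable {p : W →ₗ[F'] F'} {g : V → W} (hg : IsCollinearLift F p g)
include hg

theorem ne_zero (x : V) : g x ≠ 0 := fun h => by
  have := hg.map_one x
  rw [h, map_zero] at this
  exact zero_ne_one this

theorem smul_mem {U : Submodule F' W} {x v : V} (hx : g x ∈ U) (hv : g (x + v) ∈ U) (t : F) :
    g (x + t • v) ∈ U :=
  span_le.2 (Set.insert_subset hx (Set.singleton_subset_iff.2 hv)) (hg.mem_span x v t)

/-- With a scalar `c ≠ 0, 1`, the point `x + v + w` lies on the join of `x + (1 - c)⁻¹ • v` and `x +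
c⁻¹ • w`. This is where order two is excluded. -/
theorem add_mem {U : Submodule F' W} {x v w : V} (hx : g x ∈ U) (hv : g (x + v) ∈ U)
    (hw : g (x + w) ∈ U) : g (x + (v + w)) ∈ U := by
  obtain ⟨c, hc0, hc1⟩ := hg.exists_scalar
  have hc : 1 - c ≠ 0 := sub_ne_zero.2 hc1.symm
  have h1 := hg.smul_mem hx hv (1 - c)⁻¹
  have h2 := hg.smul_mem hx hw c⁻¹
  have h3 := hg.smul_mem (x := x + (1 - c)⁻¹ • v) (v := c⁻¹ • w - (1 - c)⁻¹ • v) h1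
    (by convert h2 using 2; abel) c
  convert h3 using 2
  rw [smul_sub, smul_smul, mul_inv_cancel₀ hc0, one_smul]
  have : v = (1 - c) • (1 - c)⁻¹ • v := by rw [smul_smul, mul_inv_cancel₀ hc, one_smul]
  nth_rewrite 1 [this]
  rw [sub_smul, one_smul]
  abel

/-- Otherwise `add_mem` confines the whole image to the span of three vectors. -/
theorem notMem_span {v₁ v₂ v₃ : V} (hv : Generates F v₁ v₂ v₃) (x : V) :
    g (x + v₃) ∉ span F' {g x, g (x + v₁), g (x + v₂)} := fun h => by
  obtain ⟨y, hy⟩ := hg.exists_notMem (g x) (g (x + v₁)) (g (x + v₂))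
  obtain ⟨a, b, c, habc⟩ := hv (y - x)
  have h0 : g x ∈ span F' {g x, g (x + v₁), g (x + v₂)} := subset_span (by simp)
  have h1 : g (x + v₁) ∈ span F' {g x, g (x + v₁), g (x + v₂)} := subset_span (by simp)
  have h2 : g (x + v₂) ∈ span F' {g x, g (x + v₁), g (x + v₂)} := subset_span (by simp)
  have := hg.add_mem h0 (hg.add_mem h0 (hg.smul_mem h0 h1 a) (hg.smul_mem h0 h2 b))
    (hg.smul_mem h0 h c)
  rw [← habc, add_sub_cancel] at this
  exact hy this

theorem notMem_span_pair {v₁ v₂ v₃ : V} (hv : Generates F v₁ v₂ v₃) (x : V) :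
    g (x + v₂) ∉ span F' {g x, g (x + v₁)} := fun h =>
  hg.notMem_span hv.swap_right x (span_mono (by
    intro y; simp only [Set.mem_insert_iff, Set.mem_singleton_iff]; tauto) h)

theorem notMem_span_singleton {v₁ v₂ v₃ : V} (hv : Generates F v₁ v₂ v₃) (x : V) :
    g (x + v₁) ∉ span F' {g x} := fun h =>
  hg.notMem_span_pair hv.swap_left x (span_mono (by simp) h)

/-- Two lines in the same direction have at most one projective point in common. -/
theorem exists_smul_eq {v₁ v₂ v₃ : V} (hv : Generates F v₁ v₂ v₃) {x y : V} (hy : y = x + v₂)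
    {w w' : W} (hw : w ≠ 0) (hwx : w ∈ span F' {g x, g (x + v₁)})
    (hwy : w ∈ span F' {g y, g (y + v₁)}) (hwx' : w' ∈ span F' {g x, g (x + v₁)})
    (hwy' : w' ∈ span F' {g y, g (y + v₁)}) : ∃ c : F', w' = c • w := by
  have hyx : g y ∉ span F' {g x, g (x + v₁)} := hy ▸ hg.notMem_span_pair hv x
  obtain ⟨a, b, rfl⟩ := mem_span_pair.1 hwy
  obtain ⟨a', b', rfl⟩ := mem_span_pair.1 hwy'
  have hcoef : ∀ c : F', c • g y ∈ span F' {g x, g (x + v₁)} → c = 0 := fun c hc => by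
    by_contra hne
    exact hyx ((Submodule.smul_mem_iff _ hne).1 hc)
  have hb : b ≠ 0 := by
    rintro rfl
    rw [zero_smul, add_zero] at hwx hw
    exact hw (by rw [hcoef a hwx, zero_smul])
  refine ⟨b' * b⁻¹, ?_⟩
  have h1 := Submodule.sub_mem _ hwx' (Submodule.smul_mem _ (b' * b⁻¹) hwx)
  have h2 : a' • g y + b' • g (y + v₁) - (b' * b⁻¹) • (a • g y + b • g (y + v₁)) =
      (a' - b' * b⁻¹ * a) • g y := by
    simp only [smul_add, smul_smul, sub_smul, inv_mul_cancel_right₀ hb]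
    abel
  rw [h2] at h1
  rw [hcoef _ h1, zero_smul, sub_eq_zero] at h2
  exact h2

/-- Three non-coplanar lines in the same direction have images which are concurrent in the
projective closure. -/
theorem exists_mem_span_three {v₁ v₂ v₃ : V} (hv : Generates F v₁ v₂ v₃) {x y z : V}
    (hy : y = x + v₂) (hz : z = x + v₃) :
    ∃ w ≠ 0, w ∈ span F' {g x, g (x + v₁)} ∧ w ∈ span F' {g y, g (y + v₁)} ∧
      w ∈ span F' {g z, g (z + v₁)} := by
  -- Coplanarity of parallel lines: `q` is where the images of the lines through `x` and `z` meet.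
  -- Comparing the values for `x` and `y` modulo `M`, which misses `g z`, shows that they agree.
  have key : ∀ x z : V, ∃ q ∈ span F' {g x, g (x + v₁)}, ∃ c : F', g (z + v₁) = c • g z + q := by
    intro x z
    have hmem : g (z + v₁) ∈ span F' {g z, g x, g (x + v₁)} := by
      have := hg.add_mem (U := span F' {g z, g x, g (x + v₁)}) (x := x) (v := z - x) (w := v₁)
        (subset_span (by simp)) (subset_span (by simp)) (subset_span (by simp))
      convert this using 2
      abel
    obtain ⟨c, q, hq, h⟩ := mem_span_insert.1 hmem
    exact ⟨q, hq, c, h⟩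
  obtain ⟨q, hq, c, hc⟩ := key x z
  obtain ⟨q', hq', c', hc'⟩ := key y z
  set M := span F' {g x, g (x + v₁), g y} with hM
  have hxM : span F' {g x, g (x + v₁)} ≤ M := span_mono (by
    intro y; simp only [Set.mem_insert_iff, Set.mem_singleton_iff]; tauto)
  have hyM : span F' {g y, g (y + v₁)} ≤ M := by
    rw [span_le, Set.insert_subset_iff, Set.singleton_subset_iff]
    refine ⟨subset_span (by simp), ?_⟩
    obtain ⟨r, hr, d, hd⟩ := key x y
    rw [hd]
    exact Submodule.add_mem _ (Submodule.smul_mem _ _ (subset_span (by simp))) (hxM hr)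
  have hzM : g z ∉ M := by
    rw [hM, hy, hz]
    exact hg.notMem_span hv x
  have hsub : (c - c') • g z = q' - q := by
    rw [sub_smul, sub_eq_sub_iff_add_eq_add, ← hc, add_comm q', ← hc']
  have hcc : c - c' = 0 := by
    by_contra hne
    refine hzM ((Submodule.smul_mem_iff _ hne).1 ?_)
    rw [hsub]
    exact Submodule.sub_mem _ (hyM hq') (hxM hq)
  rw [hcc, zero_smul, eq_comm, sub_eq_zero] at hsub
  subst hsub
  refine ⟨q', ?_, hq, hq', ?_⟩
  · rintro rfl
    refine hg.notMem_span_singleton hv z ?_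
    rw [hc, add_zero]
    exact Submodule.smul_mem _ _ (mem_span_singleton_self _)
  · rw [mem_span_pair]
    exact ⟨-c, 1, by rw [hc, one_smul, neg_smul, neg_add_cancel_left]⟩

/-- The common point of the lines through `0`, `v₂`, `v₃` serves for every line: a point `x` off the
line through `0` can replace `v₂` or `v₃`, and two of the lines already determine the point up to a
factor. -/
theorem exists_isDirection {v₁ v₂ v₃ : V} (hv : Generates F v₁ v₂ v₃) :
    ∃ w, IsDirection F' g v₁ w := by
  obtain ⟨w, hw0, hwx, hwy, hwz⟩ := hg.exists_mem_span_three hv (x := 0) rfl rfl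
  refine ⟨w, hw0, fun x => ?_⟩
  obtain ⟨a, b, c, rfl⟩ := hv x
  by_cases hc : c = 0
  · by_cases hb : b = 0
    · subst hb hc
      simp only [zero_smul, add_zero]
      have hswap : span F' {g 0, g (0 + v₁)} ≤ span F' {g (a • v₁), g (a • v₁ + v₁)} := by
        have h4 := hg.mem_span (a • v₁) v₁ (-a)
        have h5 := hg.mem_span (a • v₁) v₁ (1 - a)
        rw [span_le, Set.insert_subset_iff, Set.singleton_subset_iff]
        rw [← add_smul, add_sub_cancel, one_smul] at h5
        exact ⟨by simpa using h4, by simpa using h5⟩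
      exact hswap hwx
    · have hv' := (hv.swap_right.replace a c hb)
      have e : a • v₁ + c • v₃ + b • v₂ = a • v₁ + b • v₂ + c • v₃ := by abel
      rw [e] at hv'
      obtain ⟨w', hw0', h1, h2, h3⟩ := hg.exists_mem_span_three hv' (x := 0) rfl rfl
      obtain ⟨d, rfl⟩ := hg.exists_smul_eq hv.swap_right (x := 0) rfl hw0' h1 h2 hwx hwz
      simpa using Submodule.smul_mem _ d h3
  · have hv' := hv.replace a b hc
    obtain ⟨w', hw0', h1, h2, h3⟩ := hg.exists_mem_span_three hv' (x := 0) rfl rfl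
    obtain ⟨d, rfl⟩ := hg.exists_smul_eq hv (x := 0) rfl hw0' h1 h2 hwx hwy
    simpa using Submodule.smul_mem _ d h3

/-- A common point of the image lines cannot be an image point `g x`, since `g x` is not on the
image of the parallel line through `x + v₂`. -/
theorem ne_smul_of_isDirection {v₁ v₂ v₃ : V} (hv : Generates F v₁ v₂ v₃) {w : W}
    (hw : IsDirection F' g v₁ w) (x : V) (c : F') : w ≠ c • g x := by
  rintro rfl
  have hc : c ≠ 0 := by
    rintro rfl
    exact hw.1 (zero_smul _ _)
  have hv' := hv.replace 0 (-1) (c := 1) one_ne_zero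
  have h := hg.notMem_span_pair (v₂ := -v₂) (v₃ := v₃) (fun y => by
    obtain ⟨a, b, c, rfl⟩ := hv y
    exact ⟨a, -b, c, by simp⟩) (x + v₂) (v₁ := v₁)
  rw [add_neg_cancel_right] at h
  exact h ((Submodule.smul_mem_iff _ hc).1 (hw.2 _))

/-- With `w` as point at infinity, `s` is an affine coordinate on the image line; `k` is a
projective factor. -/
theorem exists_smul_add {v₁ v₂ v₃ : V} (hv : Generates F v₁ v₂ v₃) {w : W}
    (hw : IsDirection F' g v₁ w) (x : V) (t : F) :
    ∃ k s : F', k ≠ 0 ∧ g (x + t • v₁) = k • (g x + s • w) := by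
  obtain ⟨a, b, hab⟩ := mem_span_pair.1 (hw.2 x)
  have hb : b ≠ 0 := by
    rintro rfl
    rw [zero_smul, add_zero] at hab
    exact hg.ne_smul_of_isDirection hv hw x a hab.symm
  have hle : span F' {g x, g (x + v₁)} ≤ span F' {g x, w} := by
    rw [span_le, Set.insert_subset_iff, Set.singleton_subset_iff]
    refine ⟨subset_span (by simp), mem_span_pair.2 ⟨-(b⁻¹ * a), b⁻¹, ?_⟩⟩
    rw [← hab, smul_add, smul_smul, smul_smul, inv_mul_cancel₀ hb, one_smul, neg_smul,
      neg_add_cancel_left]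
  obtain ⟨k, r, hkr⟩ := mem_span_pair.1 (hle (hg.mem_span x v₁ t))
  have hk : k ≠ 0 := by
    rintro rfl
    rw [zero_smul, zero_add] at hkr
    have hr : r ≠ 0 := by
      rintro rfl
      rw [zero_smul] at hkr
      exact hg.ne_zero _ hkr.symm
    refine hg.ne_smul_of_isDirection hv hw (x + t • v₁) r⁻¹ ?_
    rw [← hkr, smul_smul, inv_mul_cancel₀ hr, one_smul]
  refine ⟨k, k⁻¹ * r, hk, ?_⟩
  rw [smul_add, smul_smul, mul_inv_cancel_left₀ hk, hkr]

/-- A direction vector can be scaled so that it joins `g 0` with `g v`. -/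
theorem exists_isDirection_normalized {v₁ v₂ v₃ : V} (hv : Generates F v₁ v₂ v₃) :
    ∃ w, IsDirection F' g v₁ w ∧ ∃ k : F', k ≠ 0 ∧ g v₁ = k • (g 0 + w) := by
  obtain ⟨w, hw⟩ := hg.exists_isDirection hv
  obtain ⟨k, s, hk, h⟩ := hg.exists_smul_add hv hw 0 1
  rw [one_smul, zero_add] at h
  have hs : s ≠ 0 := by
    rintro rfl
    rw [zero_smul, add_zero] at h
    refine hg.notMem_span_singleton hv 0 ?_
    rw [zero_add, h]
    exact Submodule.smul_mem _ _ (mem_span_singleton_self _)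
  exact ⟨s • w, hw.smul hs, k, hk, h⟩

/-- The field monomorphism belonging to a collinear lift. -/
theorem exists_ringHom {e₁ e₂ e₃ : V} (he : Generates F e₁ e₂ e₃) :
    ∃ (σ : F →+* F') (w : W), ∀ t : F, ∃ k : F', k ≠ 0 ∧ g (t • e₁) = k • (g 0 + σ t • w) := by
  obtain ⟨w₁, hw₁, k₁, hk₁, h₁⟩ := hg.exists_isDirection_normalized he
  obtain ⟨w₂, hw₂, k₂, hk₂, h₂⟩ := hg.exists_isDirection_normalized he.swap_left
  have m₁ : w₁ ∈ span F' {g 0, g e₁} := by simpa using hw₁.2 0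
  have m₂ : w₂ ∈ span F' {g 0, g e₂} := by simpa using hw₂.2 0
  have i₂ : w₂ ∉ span F' {g 0, w₁} := fun h => by
    refine hg.notMem_span_pair he 0 ?_
    simp only [zero_add]
    have hle : span F' {g 0, w₁} ≤ span F' {g 0, g e₁} := by
      rw [span_le, Set.insert_subset_iff, Set.singleton_subset_iff]
      exact ⟨subset_span (by simp), m₁⟩
    rw [h₂]
    exact Submodule.smul_mem _ _ (Submodule.add_mem _ (subset_span (by simp)) (hle h))
  have i₃ : g e₃ ∉ span F' {g 0, w₁, w₂} := fun h => by
    refine hg.notMem_span he 0 ?_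
    simp only [zero_add]
    have hle : span F' {g 0, w₁, w₂} ≤ span F' {g 0, g e₁, g e₂} := by
      rw [span_le, Set.insert_subset_iff, Set.insert_subset_iff, Set.singleton_subset_iff]
      refine ⟨subset_span (by simp), span_mono ?_ m₁, span_mono ?_ m₂⟩ <;>
      · intro y; simp only [Set.mem_insert_iff, Set.mem_singleton_iff]; tauto
    exact hle h
  have ind : ∀ a b c : F', a • g 0 + b • w₁ + c • w₂ = 0 → a = 0 ∧ b = 0 ∧ c = 0 := by
    intro a b c h
    have hc : c = 0 := by
      by_contra hc
      refine i₂ ((Submodule.smul_mem_iff _ hc).1 ?_)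
      rw [← neg_eq_of_add_eq_zero_right h]
      exact neg_mem (mem_span_pair.2 ⟨a, b, rfl⟩)
    subst hc
    rw [zero_smul, add_zero] at h
    have hb : b = 0 := by
      by_contra hb
      refine hg.ne_smul_of_isDirection he hw₁ 0 (b⁻¹ * -a) ?_
      rw [mul_smul, neg_smul, neg_eq_of_add_eq_zero_right h, smul_smul, inv_mul_cancel₀ hb,
        one_smul]
    subst hb
    rw [zero_smul, add_zero] at h
    exact ⟨(smul_eq_zero.1 h).resolve_right (hg.ne_zero 0), rfl, rfl⟩
  have uniq : ∀ {a b c a' b' c' : F'}, a • g 0 + b • w₁ + c • w₂ = a' • g 0 + b' • w₁ + c' • w₂ →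
      a = a' ∧ b = b' ∧ c = c' := by
    intro a b c a' b' c' h
    have := ind (a - a') (b - b') (c - c') (by
      rw [sub_smul, sub_smul, sub_smul, ← sub_eq_zero.2 h]; abel)
    simpa only [sub_eq_zero] using this
  have uniq' : ∀ {k b c k' b' c' : F'}, k ≠ 0 →
      k • (g 0 + b • w₁ + c • w₂) = k' • (g 0 + b' • w₁ + c' • w₂) → b = b' ∧ c = c' := by
    intro k b c k' b' c' hk h
    simp only [smul_add, smul_smul] at h
    obtain ⟨rfl, hb, hc⟩ := uniq h
    exact ⟨mul_left_cancel₀ hk hb, mul_left_cancel₀ hk hc⟩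
  have ex₁ : ∀ t : F, ∃ k s : F', k ≠ 0 ∧ g (t • e₁) = k • (g 0 + s • w₁) := fun t => by
    simpa using hg.exists_smul_add he hw₁ 0 t
  have ex₂ : ∀ t : F, ∃ k s : F', k ≠ 0 ∧ g (t • e₂) = k • (g 0 + s • w₂) := fun t => by
    simpa using hg.exists_smul_add he.swap_left hw₂ 0 t
  choose κ₁ σ hκ₁ hσ using ex₁
  choose κ₂ τ hκ₂ hτ using ex₂
  -- The point is on the line through `a • e₁` in direction `e₂` and on the line through `b • e₂` in
  -- direction `e₁`; each fixes one coordinate.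
  have plane : ∀ a b : F, ∃ k : F', k ≠ 0 ∧
      g (a • e₁ + b • e₂) = k • (g 0 + σ a • w₁ + τ b • w₂) := by
    intro a b
    obtain ⟨k, s, hk, h⟩ := hg.exists_smul_add he.swap_left hw₂ (a • e₁) b
    obtain ⟨l, r, hl, h'⟩ := hg.exists_smul_add he hw₁ (b • e₂) a
    have e1 : g (a • e₁ + b • e₂) =
        (k * κ₁ a) • (g 0 + σ a • w₁ + ((κ₁ a)⁻¹ * s) • w₂) := by
      rw [h, hσ, mul_smul, smul_add (κ₁ a) (_ + _), smul_smul, mul_inv_cancel_left₀ (hκ₁ a)]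
    have e2 : g (a • e₁ + b • e₂) =
        (l * κ₂ b) • (g 0 + ((κ₂ b)⁻¹ * r) • w₁ + τ b • w₂) := by
      rw [add_comm, h', hτ, mul_smul, add_right_comm, smul_add (κ₂ b) (_ + _), smul_smul,
        mul_inv_cancel_left₀ (hκ₂ b)]
    refine ⟨k * κ₁ a, mul_ne_zero hk (hκ₁ a), ?_⟩
    rw [← (uniq' (mul_ne_zero hk (hκ₁ a)) (e1.symm.trans e2)).2]
    exact e1
  have σ_one : σ 1 = 1 := by
    refine (uniq' (c := 0) (c' := 0) (hκ₁ 1) (k' := k₁) ?_).1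
    simp only [zero_smul, add_zero, one_smul]
    rw [← hσ, one_smul, h₁]
  have τ_one : τ 1 = 1 := by
    refine (uniq' (b := 0) (b' := 0) (hκ₂ 1) (k' := k₂) ?_).2
    simp only [zero_smul, add_zero, one_smul]
    rw [← hτ, one_smul, h₂]
  have he' : Generates F (e₁ + e₂) e₂ e₃ := fun x => by
    obtain ⟨a, b, c, rfl⟩ := he x
    refine ⟨a, b - a, c, ?_⟩
    rw [smul_add, sub_smul]
    abel
  obtain ⟨k₀, hk₀, h₀⟩ := plane 1 1
  simp only [one_smul, σ_one, τ_one] at h₀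
  -- The third dimension enters here: the direction of the diagonal lies in the span of `g 0`, `w₁`,
  -- `w₂`, and, from the parallel diagonal at `e₃`, in that of `g e₃`, `w₁`, `w₂`. Hence it lies on
  -- the line of `w₁` and `w₂`, and `g (e₁ + e₂)` fixes the ratio.
  have hdiag : IsDirection F' g (e₁ + e₂) (w₁ + w₂) := by
    obtain ⟨w, hw⟩ := hg.exists_isDirection he'
    obtain ⟨a, b, hab⟩ := mem_span_pair.1 (hw.2 0)
    rw [zero_add, h₀] at hab
    have hmem : w ∈ span F' {g e₃, w₁, w₂} := by
      obtain ⟨k, s, -, h⟩ := hg.exists_smul_add he hw₁ e₃ 1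
      obtain ⟨l, r, -, h'⟩ := hg.exists_smul_add he.swap_left hw₂ (e₃ + e₁) 1
      rw [one_smul] at h h'
      have hle : span F' {g e₃, g (e₃ + (e₁ + e₂))} ≤ span F' {g e₃, w₁, w₂} := by
        rw [span_le, Set.insert_subset_iff, Set.singleton_subset_iff]
        refine ⟨subset_span (by simp), ?_⟩
        rw [← add_assoc, h', h]
        have a1 : g e₃ ∈ span F' {g e₃, w₁, w₂} := subset_span (by simp)
        have a2 : w₁ ∈ span F' {g e₃, w₁, w₂} := subset_span (by simp)
        have a3 : w₂ ∈ span F' {g e₃, w₁, w₂} := subset_span (by simp)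
        exact Submodule.smul_mem _ _ (Submodule.add_mem _ (Submodule.smul_mem _ _
          (Submodule.add_mem _ a1 (Submodule.smul_mem _ _ a2))) (Submodule.smul_mem _ _ a3))
      exact hle (hw.2 e₃)
    obtain ⟨c, z, hz, hwz⟩ := mem_span_insert.1 hmem
    obtain ⟨d₁, d₂, rfl⟩ := mem_span_pair.1 hz
    have hw' : w = (a + b * k₀) • g 0 + (b * k₀) • w₁ + (b * k₀) • w₂ := by
      rw [← hab]
      simp only [smul_add, smul_smul, add_smul]
      abel
    have hc : c = 0 := by
      by_contra hc
      refine i₃ ((Submodule.smul_mem_iff _ hc).1 ?_)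
      have : c • g e₃ = w - (d₁ • w₁ + d₂ • w₂) := by rw [hwz]; abel
      rw [this, hw']
      have a1 : g 0 ∈ span F' {g 0, w₁, w₂} := subset_span (by simp)
      have a2 : w₁ ∈ span F' {g 0, w₁, w₂} := subset_span (by simp)
      have a3 : w₂ ∈ span F' {g 0, w₁, w₂} := subset_span (by simp)
      exact Submodule.sub_mem _ (Submodule.add_mem _ (Submodule.add_mem _
        (Submodule.smul_mem _ _ a1) (Submodule.smul_mem _ _ a2)) (Submodule.smul_mem _ _ a3))
        (Submodule.add_mem _ (Submodule.smul_mem _ _ a2) (Submodule.smul_mem _ _ a3))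
    have ha : a + b * k₀ = 0 := by
      refine (uniq (a' := 0) (b' := d₁) (c' := d₂) (hw'.symm.trans ?_)).1
      rw [hwz, hc]
      simp only [zero_smul, zero_add]
    rw [ha, zero_smul, zero_add, ← smul_add] at hw'
    have hbk : b * k₀ ≠ 0 := fun h => hw.1 (by rw [hw', h, zero_smul])
    have := hw.smul (inv_ne_zero hbk)
    rwa [hw', smul_smul, inv_mul_cancel₀ hbk, one_smul] at this
  have hστ : ∀ t, σ t = τ t := by
    intro t
    obtain ⟨k, s, hk, h⟩ := hg.exists_smul_add he' hdiag 0 t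
    obtain ⟨l, hl, h'⟩ := plane t t
    rw [zero_add, smul_add, h', smul_add s, ← add_assoc] at h
    obtain ⟨h3, h4⟩ := uniq' hl h
    rw [h3, h4]
  -- The diagonal through `s • e₁` contains `(s + t) • e₁ + t • e₂`.
  have σ_add : ∀ s t, σ (s + t) = σ s + σ t := by
    intro s t
    obtain ⟨k, r, hk, h⟩ := hg.exists_smul_add he' hdiag (s • e₁) t
    obtain ⟨l, hl, h'⟩ := plane (s + t) t
    rw [smul_add, ← add_assoc, ← add_smul, h', hσ] at h
    have e : k • (κ₁ s • (g 0 + σ s • w₁) + r • (w₁ + w₂)) = (k * κ₁ s) •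
        (g 0 + (σ s + (κ₁ s)⁻¹ * r) • w₁ + ((κ₁ s)⁻¹ * r) • w₂) := by
      simp only [smul_add, smul_smul, add_smul, mul_assoc,
        mul_inv_cancel_left₀ (hκ₁ s)]
      abel
    rw [e] at h
    obtain ⟨h3, h4⟩ := uniq' hl h
    rw [h3, hστ t, h4]
  -- The line through `0` of slope `m` contains `t • e₁ + (t * m) • e₂`.
  have σ_mul : ∀ t m, σ (t * m) = σ t * σ m := by
    intro t m
    obtain ⟨k, hk, h⟩ := plane 1 m
    obtain ⟨l, hl, h'⟩ := plane t (t * m)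
    obtain ⟨a, b, hab⟩ := mem_span_pair.1 (hg.mem_span 0 ((1 : F) • e₁ + m • e₂) t)
    rw [zero_add, zero_add, smul_add, smul_smul, smul_smul, mul_one, h, h', σ_one, one_smul,
      ← hστ, ← hστ] at hab
    have e : (a + b * k) • g 0 + (b * k) • w₁ + (b * k * σ m) • w₂ =
        l • g 0 + (l * σ t) • w₁ + (l * σ (t * m)) • w₂ := by
      simp only [smul_add, smul_smul] at hab
      rw [← hab, add_smul, mul_assoc b k]
      abel
    obtain ⟨-, h3, h4⟩ := uniq e
    rw [h3, mul_assoc] at h4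
    exact (mul_left_cancel₀ hl h4).symm
  exact ⟨RingHom.mk' ⟨⟨σ, σ_one⟩, σ_mul⟩ σ_add, w₁, fun t => ⟨κ₁ t, hκ₁ t, hσ t⟩⟩

/-- If every field monomorphism is surjective, then lines are mapped onto lines. -/
theorem mem_range_of_mem_span (hsurj : ∀ σ : F →+* F', Function.Surjective σ) {e₁ e₂ e₃ : V}
    (he : Generates F e₁ e₂ e₃) {w : W} (hw : w ∈ span F' {g 0, g e₁}) (hpw : p w = 1) :
    w ∈ Set.range g := by
  obtain ⟨σ, w₁, h⟩ := hg.exists_ringHom he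
  have hσ := hsurj σ
  have hp : ∀ t k, g (t • e₁) = k • (g 0 + σ t • w₁) → k * (1 + σ t * p w₁) = 1 := by
    intro t k ht
    have := congrArg p ht
    rw [hg.map_one, map_smul, map_add, map_smul, hg.map_one, smul_eq_mul, smul_eq_mul] at this
    exact this.symm
  -- Otherwise surjectivity of `σ` yields an image point with `p`-value `0`: the direction must be
  -- at infinity.
  have hw₁ : p w₁ = 0 := by
    by_contra hne
    obtain ⟨t, ht⟩ := hσ (-(p w₁)⁻¹)
    obtain ⟨k, -, hk⟩ := h t
    have := hp t k hk
    rw [ht, neg_mul, inv_mul_cancel₀ hne, add_neg_cancel, mul_zero] at this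
    exact zero_ne_one this
  have h' : ∀ t, g (t • e₁) = g 0 + σ t • w₁ := by
    intro t
    obtain ⟨k, -, hk⟩ := h t
    have := hp t k hk
    rw [hw₁, mul_zero, add_zero, mul_one] at this
    rw [hk, this, one_smul]
  have h1 : g e₁ = g 0 + w₁ := by simpa using h' 1
  obtain ⟨a, b, rfl⟩ := mem_span_pair.1 hw
  obtain ⟨t, rfl⟩ := hσ b
  rw [map_add, map_smul, map_smul, hg.map_one, hg.map_one, smul_eq_mul, smul_eq_mul, mul_one,
    mul_one] at hpw
  refine ⟨t • e₁, ?_⟩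
  rw [h', h1, smul_add, ← add_assoc, ← add_smul, hpw, one_smul]

end IsCollinearLift

end Lift

/-! ### Coordinates and the case of underlying fields -/

namespace AffineSpace

section Coordinates

variable {P : Type u} {A : AffineSpace P} {F : Type*} [DivisionRing F] {V : Type u}
  [AddCommGroup V] [AddTorsor V P]

variable (F) in
/-- The points of an affine space as vectors with first coordinate one. -/
def homogenize (o x : P) : F × V := (1, x -ᵥ o)

theorem homogenize_injective (o : P) : Function.Injective (homogenize F (V := V) o) :=
  fun _ _ h => vsub_left_injective o (congrArg Prod.snd h)

variable [Module F V]

theorem smul_vsub_vadd_mem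
    (hlines : ∀ s : Set P, s ∈ A.lines ↔ ∃ (p : P) (x : V), x ≠ 0 ∧ s = vectorLine F p x)
    (hpar : ∀ l m : A.lines, A.Parallel l m ↔
      ∃ (p q : P) (x : V), x ≠ 0 ∧ l.1 = vectorLine F p x ∧ m.1 = vectorLine F q x)
    {S : Set P} (hS : A.IsSubspace S) {x y z : P} (hx : x ∈ S) (hy : y ∈ S) (hz : z ∈ S) (t : F) :
    t • (y -ᵥ x) +ᵥ z ∈ S := by
  rcases eq_or_ne x y with rfl | hxy
  · simpa using hz
  have hv : y -ᵥ x ≠ 0 := vsub_ne_zero.2 hxy.symm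
  have mem0 : ∀ p : P, p ∈ vectorLine F p (y -ᵥ x) := fun p => ⟨0, by simp⟩
  let l : A.lines := ⟨vectorLine F x (y -ᵥ x), (hlines _).2 ⟨x, _, hv, rfl⟩⟩
  let m : A.lines := ⟨vectorLine F z (y -ᵥ x), (hlines _).2 ⟨z, _, hv, rfl⟩⟩
  have hl : l.1 ⊆ S := hS.1 l x hx y hy hxy (mem0 x) ⟨1, by simp⟩
  exact hS.2 l m z hz hl (mem0 z) ((hpar m l).2 ⟨z, x, _, hv, rfl, rfl⟩) ⟨t, rfl⟩

theorem homogenize_mem_span_pair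
    (hlines : ∀ s : Set P, s ∈ A.lines ↔ ∃ (p : P) (x : V), x ≠ 0 ∧ s = vectorLine F p x)
    (o : P) {l : A.lines} {x y z : P} (hxy : x ≠ y) (hx : x ∈ l.1) (hy : y ∈ l.1) (hz : z ∈ l.1) :
    homogenize F (V := V) o z ∈ Submodule.span F {homogenize F o x, homogenize F o y} := by
  obtain ⟨p, v, -, hl⟩ := (hlines l.1).1 l.2
  rw [hl] at hx hy hz
  obtain ⟨a, rfl⟩ := hx
  obtain ⟨b, rfl⟩ := hy
  obtain ⟨c, rfl⟩ := hz
  have hba : b - a ≠ 0 := sub_ne_zero.2 fun h => hxy (by rw [h])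
  refine Submodule.mem_span_pair.2 ⟨1 - (c - a) * (b - a)⁻¹, (c - a) * (b - a)⁻¹, ?_⟩
  set d := (c - a) * (b - a)⁻¹ with hd
  have hc : c = a + d * (b - a) := by rw [hd, inv_mul_cancel_right₀ hba, add_sub_cancel]
  refine Prod.ext (by simp [homogenize]) ?_
  simp only [homogenize, Prod.snd_add, Prod.smul_snd, vadd_vsub_assoc]
  rw [hc]
  simp only [sub_smul, smul_add, add_smul, mul_sub, sub_mul, one_mul, one_smul, smul_smul]
  abel

/-- First coordinates force the coefficients to sum to one, so `w = x + b (y - x) + c (z - x)`,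
which is built by joining and drawing parallels. -/
theorem mem_span_of_homogenize_mem
    (hlines : ∀ s : Set P, s ∈ A.lines ↔ ∃ (p : P) (x : V), x ≠ 0 ∧ s = vectorLine F p x)
    (hpar : ∀ l m : A.lines, A.Parallel l m ↔
      ∃ (p q : P) (x : V), x ≠ 0 ∧ l.1 = vectorLine F p x ∧ m.1 = vectorLine F q x)
    {o x y z w : P} (hw : homogenize F (V := V) o w ∈
      Submodule.span F {homogenize F o x, homogenize F o y, homogenize F o z}) :
    w ∈ A.span {x, y, z} := by
  obtain ⟨a, b, c, h⟩ := Submodule.mem_span_triple.1 hw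
  have h1 : a + b + c = 1 := by simpa [homogenize] using congrArg Prod.fst h
  have h2 : a • (x -ᵥ o) + b • (y -ᵥ o) + c • (z -ᵥ o) = w -ᵥ o := by
    simpa [homogenize] using congrArg Prod.snd h
  have hS := isSubspace_span (A := A) {x, y, z}
  have hx : x ∈ A.span {x, y, z} := subset_span _ (by simp)
  have hmem := smul_vsub_vadd_mem hlines hpar hS hx (subset_span _ (by simp) : z ∈ A.span {x, y, z})
    (smul_vsub_vadd_mem hlines hpar hS hx (subset_span _ (by simp) : y ∈ A.span {x, y, z}) hx b) c
  convert hmem using 1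
  apply vsub_left_injective o
  simp only [vadd_vsub_assoc]
  rw [← h2, ← vsub_sub_vsub_cancel_right z x o, ← vsub_sub_vsub_cancel_right y x o]
  have : a = 1 - b - c := by rw [← h1]; abel
  rw [this]
  simp only [sub_smul, smul_sub, one_smul]
  abel

theorem exists_ne_zero_ne_one
    (hlines : ∀ s : Set P, s ∈ A.lines ↔ ∃ (p : P) (x : V), x ≠ 0 ∧ s = vectorLine F p x)
    (h2 : ¬ A.HasOrder 2) : ∃ c : F, c ≠ 0 ∧ c ≠ 1 := by
  by_contra! hc
  refine h2 fun l => ?_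
  obtain ⟨p, x, hx, hl⟩ := (hlines l.1).1 l.2
  rw [hl, Cardinal.mk_eq_two_iff]
  refine ⟨⟨(0 : F) • x +ᵥ p, 0, rfl⟩, ⟨(1 : F) • x +ᵥ p, 1, rfl⟩, fun h => ?_, ?_⟩
  · have h' : (0 : F) • x +ᵥ p = (1 : F) • x +ᵥ p := congrArg Subtype.val h
    rw [vadd_right_cancel_iff, zero_smul, one_smul] at h'
    exact hx h'.symm
  · refine Set.eq_univ_of_forall ?_
    rintro ⟨_, t, rfl⟩
    by_cases ht : t = 0
    · left; subst ht; rfl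
    · right; obtain rfl := hc t ht; rfl

end Coordinates

variable {P : Type u} {P' : Type u'} {A : AffineSpace P} {A' : AffineSpace P'}
  {φ : A.lines → A'.lines} {f : P → P'}

theorem IsLineEmbedding.surjective_of_underlyingField (h : A.IsLineEmbedding A' φ f)
    (hdim : 3 ≤ A'.dim) {F F' : Type*} [DivisionRing F] [DivisionRing F']
    (hF : A.IsUnderlyingField F) (hF' : A'.IsUnderlyingField F') (h2 : ¬ A.HasOrder 2)
    (hσ : ∀ σ : F →+* F', Function.Surjective σ) : Function.Surjective f := by
  obtain ⟨V, _, _, _, hl, -⟩ := hF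
  obtain ⟨V', _, _, _, hl', hp'⟩ := hF'
  intro x'
  obtain ⟨l⟩ := exists_line hdim
  obtain ⟨a, ha⟩ := h.surjective (A'.par x' l)
  have hx' : x' ∈ (φ a).1 := ha ▸ A'.mem_par x' l
  obtain ⟨p, hp⟩ := A.exists_mem a
  obtain ⟨q, hq, hqp⟩ := A.exists_ne_mem a p
  have hne : ∀ S : Set P', A'.IsSubspace S → S ≠ Set.univ → ∃ r, f r ∉ S := fun S hS hS' => by
    by_contra! hr
    exact hS' (h.eq_univ_of_range_subset hdim hS hr)
  obtain ⟨r, hr⟩ := hne _ (isSubspace_span _) (span_pair_ne_univ hdim (h.injective.ne hqp))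
  have hrq : f r ≠ f q := fun e => hr (e ▸ subset_span _ (by simp))
  have hrp : f r ≠ f p := fun e => hr (e ▸ subset_span _ (by simp))
  obtain ⟨s, hs⟩ := hne _ (isSubspace_span _)
    (span_triple_ne_univ hdim hrq hrp (h.injective.ne hqp))
  set ι : P' → F' × V' := homogenize F' (f p) with hι
  -- Four independent image points guarantee that the lift restricted to the space through `p`, `q`,
  -- `r`, `s` is not contained in a plane.
  have hind : LinearIndependent F' ![ι (f s), ι (f r), ι (f q), ι (f p)] := by
    have hqp' : ι (f q) ∉ Submodule.span F' {ι (f p)} := fun hmem => by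
      obtain ⟨c, hc⟩ := Submodule.mem_span_singleton.1 hmem
      have h1 : c = 1 := by simpa [hι, homogenize] using congrArg Prod.fst hc
      rw [h1, one_smul] at hc
      exact h.injective.ne hqp (homogenize_injective _ hc.symm)
    have hr' : ι (f r) ∉ Submodule.span F' {ι (f q), ι (f p)} := fun hmem =>
      hr (by
        have := mem_span_of_homogenize_mem hl' hp' (o := f p) (x := f q) (y := f q) (z := f p)
          (w := f r) (by simpa using hmem)
        simpa using this)
    have hs' : ι (f s) ∉ Submodule.span F' {ι (f r), ι (f q), ι (f p)} := fun hmem =>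
      hs (mem_span_of_homogenize_mem hl' hp' hmem)
    have hp0 : ι (f p) ≠ 0 := fun e => by
      simpa [hι, homogenize] using congrArg Prod.fst e
    refine linearIndependent_finCons.2 ⟨linearIndependent_finCons.2
      ⟨linearIndependent_finCons.2 ⟨?_, ?_⟩, ?_⟩, ?_⟩
    · exact LinearIndependent.of_subsingleton 0 hp0
    · simpa using hqp'
    · simpa [Matrix.range_cons, Matrix.range_empty, Set.pair_comm] using hr'
    · rwa [Matrix.range_cons, Matrix.range_cons_cons_empty, Set.singleton_union]
  -- Restricting to at most three dimensions makes `Generates` available; `e₁` is the direction of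
  -- the line `a` whose image contains `x'`.
  let T : Submodule F V := Submodule.span F {q -ᵥ p, r -ᵥ p, s -ᵥ p}
  let e₁ : T := ⟨q -ᵥ p, Submodule.subset_span (by simp)⟩
  let e₂ : T := ⟨r -ᵥ p, Submodule.subset_span (by simp)⟩
  let e₃ : T := ⟨s -ᵥ p, Submodule.subset_span (by simp)⟩
  have he : Generates F e₁ e₂ e₃ := by
    rintro ⟨x, hx⟩
    obtain ⟨a, b, c, habc⟩ := Submodule.mem_span_triple.1 hx
    exact ⟨a, b, c, Subtype.ext habc.symm⟩
  let g : T → F' × V' := fun x => ι (f ((x : V) +ᵥ p))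
  have g0 : g 0 = ι (f p) := by simp [g]
  have g1 : g e₁ = ι (f q) := by simp [g, e₁]
  have g2 : g e₂ = ι (f r) := by simp [g, e₂]
  have g3 : g e₃ = ι (f s) := by simp [g, e₃]
  have hg : IsCollinearLift F (LinearMap.fst F' F' V') g := by
    refine ⟨fun x => rfl, fun x v t => ?_, fun a b c => ?_, exists_ne_zero_ne_one hl h2⟩
    · by_cases hv : v = 0
      · subst hv
        rw [smul_zero, add_zero]
        exact Submodule.subset_span (by simp)
      have hv' : (v : V) ≠ 0 := fun e => hv (Subtype.ext e)
      let m : A.lines := ⟨vectorLine F ((x : V) +ᵥ p) (v : V), (hl _).2 ⟨_, _, hv', rfl⟩⟩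
      have hm : ∀ t : F, ((x + t • v : T) : V) +ᵥ p ∈ m.1 := fun t =>
        ⟨t, by simp [vadd_vadd, add_comm]⟩
      have hm0 : (x : V) +ᵥ p ∈ m.1 := by simpa using hm 0
      have hm1 : ((x + v : T) : V) +ᵥ p ∈ m.1 := by simpa using hm 1
      refine homogenize_mem_span_pair hl' _ (h.injective.ne fun e => ?_)
        ((h.mem_iff m _).1 hm0) ((h.mem_iff m _).1 hm1) ((h.mem_iff m _).1 (hm t))
      rw [vadd_right_cancel_iff] at e
      exact hv' (by simpa using e)
    · by_contra! hall
      classical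
      have hsub : Set.range ![ι (f s), ι (f r), ι (f q), ι (f p)] ⊆
          Submodule.span F' (({a, b, c} : Finset (F' × V')) : Set (F' × V')) := by
        rintro _ ⟨i, rfl⟩
        simp only [Finset.coe_insert, Finset.coe_singleton]
        fin_cases i
        · exact g3 ▸ hall e₃
        · exact g2 ▸ hall e₂
        · exact g1 ▸ hall e₁
        · exact g0 ▸ hall 0
      have h4 := linearIndependent_le_span' _ hind
        (({a, b, c} : Finset (F' × V')) : Set (F' × V')) hsub
      rw [Cardinal.mk_fin, Nat.cast_le] at h4
      exact absurd (h4.trans ((Fintype.card_coe _).trans_le Finset.card_le_three)) (by decide)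
  have hmem : ι x' ∈ Submodule.span F' {g 0, g e₁} := by
    rw [g0, g1]
    exact homogenize_mem_span_pair hl' _ (h.injective.ne hqp.symm) ((h.mem_iff a p).1 hp)
      ((h.mem_iff a q).1 hq) hx'
  obtain ⟨x, hx⟩ := hg.mem_range_of_mem_span hσ he hmem rfl
  exact ⟨_, homogenize_injective _ hx⟩

end AffineSpace

theorem theorem4 {P : Type u} {P' : Type u'} (A : AffineSpace P) (A' : AffineSpace P')
    (hdim : 3 ≤ A'.dim) (φ : A.lines → A'.lines) (hφ : Function.Bijective φ)
    (hrel : ∀ a b : A.lines, A.Related a b → A'.Related (φ a) (φ b)) :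
    (∃! lam : P → P', A.IsInducedBy A' φ lam) ∧
    ∀ lam : P → P', A.IsInducedBy A' φ lam →
      (Finite P ∨ Finite P' → A.IsCollineation A' lam) ∧
      (A.dim ≤ A'.dim ∧ A'.dim < ⊤ → A.IsCollineation A' lam) ∧
      (∀ (F : Type*) (F' : Type*) [DivisionRing F] [DivisionRing F'],
        A.IsUnderlyingField F → A'.IsUnderlyingField F' →
        ¬ A.HasOrder 2 → (∀ σ : F →+* F', Function.Surjective σ) →
        A.IsCollineation A' lam) ∧
      (A.HasOrder 2 ∧ A'.HasOrder 2 → A.IsCollineation A' lam) := by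
  refine ⟨AffineSpace.existsUnique_isInducedBy hdim hφ hrel, fun lam hlam => ?_⟩
  have h : A.IsLineEmbedding A' φ lam := AffineSpace.isLineEmbedding_of_mem hdim hφ
    (hlam.mem (AffineSpace.exists_ne_line_mem hdim hφ.2 hrel))
  refine ⟨fun hfin => h.isCollineation ?_, fun hle => h.isCollineation ?_,
    fun F F' _ _ hF hF' h2 hσ => h.isCollineation ?_, fun h2 => h.isCollineation ?_⟩
  · have : Finite P := hfin.elim id fun _ => Finite.of_injective lam h.injective
    exact h.surjective_of_finite hφ.1 hdim
  · exact h.surjective_of_dim_le hφ.1 hdim hle.1 hle.2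
  · exact h.surjective_of_underlyingField hdim hF hF' h2 hσ
  · exact h.surjective_of_order_two hdim h2.2
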